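/- Let $d\ge 2$ and let $\Omega\subset\mathbb R^d$ be a bounded Lipschitz domain, i.e. a bounded open set that near every boundary point lies below the graph of a Lipschitz function (in a suitable orthonormal coordinate system), with boundary $\Gamma=\partial\Omega$ and exterior unit normal $\mathbf n$. Let $H^1(\Omega)$ and $H(\mathrm{div},\Omega)$ be the spaces of real-valued functions, respectively vector fields, in $L^2(\Omega)$ whose weak gradient, respectively weak divergence, lies in $L^2(\Omega)$. Let $\varphi\mapsto\varphi|_\Gamma$ be the trace operator $H^1(\Omega)\to L^2(\Gamma)$, let $H^{1/2}(\Gamma)=\{\varphi|_\Gamma:\varphi\in H^1(\Omega)\}$, and let the normal trace $\mathbf n\cdot\boldsymbol\sigma|_\Gamma$ of $\boldsymbol\sigma\in H(\mathrm{div},\Omega)$ be the functional on $H^{1/2}(\Gamma)$ given by $$\langle\varphi|_\Gamma,\mathbf n\cdot\boldsymbol\sigma|_\Gamma\rangle_\Gamma=(\nabla\varphi,\boldsymbol\sigma)_{L^2(\Omega)}+(\varphi,\operatorname{div}\boldsymbol\sigma)_{L^2(\Omega)}\qquad(\varphi\in H^1(\Omega)).$$ Let $g\in H^{1/2}(\Gamma)$,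 and let $v\in H^1(\Omega)$ satisfy $\Delta v=0$ weakly in $\Omega$. Then the following hold. 1. There is a unique $u\in H^1(\Omega)$ with $\Delta u=0$ weakly in $\Omega$ and $u|_\Gamma=g$. 2. There is a unique pair $(\boldsymbol\tau,\omega)\in H(\mathrm{div},\Omega)\times L^2(\Omega)$ such that $$(\boldsymbol\tau,\boldsymbol\sigma)_{L^2(\Omega)}+(\operatorname{div}\boldsymbol\sigma,\omega)_{L^2(\Omega)}=\langle g-v|_\Gamma,\mathbf n\cdot\boldsymbol\sigma|_\Gamma\rangle_\Gamma,\qquad(\operatorname{div}\boldsymbol\tau,\psi)_{L^2(\Omega)}=0$$ for all $(\boldsymbol\sigma,\psi)\in H(\mathrm{div},\Omega)\times L^2(\Omega)$. 3. This pair is $(\boldsymbol\tau,\omega)=(\nabla(u-v),\,u-v)$. Moreover, $\boldsymbol\tau$ is the unique maximiser of $2\langle g-v|_\Gamma,\mathbf n\cdot\boldsymbol\sigma|_\Gamma\rangle_\Gamma-\|\boldsymbol\sigma\|_{L^2(\Omega)}^2$ over all $\boldsymbol\sigma\in L^2(\Omega)$ with $\operatorname{div}\boldsymbol\sigma=0$,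 and $\omega=u-v$ is the unique minimiser of $\|\nabla w\|_{L^2(\Omega)}^2$ over all $w\in H^1(\Omega)$ with $w|_\Gamma=g-v|_\Gamma$. -/

import Mathlib

noncomputable section

namespace FunctionalBEM

open MeasureTheory Topology Set
open scoped Gradient

/-- Euclidean space `ℝ^d`. -/
abbrev Space (d : ℕ) : Type := EuclideanSpace ℝ (Fin d)

/-- Bounded Lipschitz domains: bounded open sets that near every boundary point lie strictly
below the graph of a Lipschitz function, in some orthonormal coordinate system. Here `e` is the
direction of the last coordinate axis, and the hyperplane orthogonal to `e` carries the other
coordinates. -/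
structure IsBoundedLipschitzDomain {d : ℕ} (Ω : Set (Space d)) : Prop where
  isOpen : IsOpen Ω
  isBounded : Bornology.IsBounded Ω
  locally_subgraph : ∀ x ∈ frontier Ω, ∃ e : Space d, ‖e‖ = 1 ∧
    ∃ (K : NNReal) (h : (Submodule.span ℝ {e})ᗮ → ℝ), LipschitzWith K h ∧
      ∃ r > 0, ∀ y ∈ Metric.ball x r,
        y ∈ Ω ↔ inner ℝ e y < h ((Submodule.span ℝ {e})ᗮ.orthogonalProjectionOnto y)

/-- The surface measure on `Γ = ∂Ω`: the normalised `(d - 1)`-dimensional Hausdorff measure. -/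
def surface {d : ℕ} (Ω : Set (Space d)) : Measure (Space d) :=
  (Measure.euclideanHausdorffMeasure (d - 1)).restrict (frontier Ω)

/-- Real-valued functions in `L²(Ω)`. -/
abbrev L2 {d : ℕ} (Ω : Set (Space d)) : Type := Lp ℝ 2 (volume.restrict Ω)

/-- Vector fields in `L²(Ω)`. -/
abbrev L2Vec {d : ℕ} (Ω : Set (Space d)) : Type := Lp (Space d) 2 (volume.restrict Ω)

/-- Real-valued functions in `L²(Γ)`. -/
abbrev L2Bdry {d : ℕ} (Ω : Set (Space d)) : Type := Lp ℝ 2 (surface Ω)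

/-- Test functions in `C_c^∞(Ω)`. -/
structure IsTestFunction {d : ℕ} (Ω : Set (Space d)) (η : Space d → ℝ) : Prop where
  smooth : ContDiff ℝ (⊤ : ℕ∞) η
  hasCompactSupport : HasCompactSupport η
  tsupport_subset : tsupport η ⊆ Ω

/-- `G` is the weak gradient of `φ` in `Ω`. -/
def IsWeakGradient {d : ℕ} (Ω : Set (Space d)) (φ : L2 Ω) (G : L2Vec Ω) : Prop :=
  ∀ η : Space d → ℝ, IsTestFunction Ω η →
    ∫ x in Ω, φ x • ∇ η x = -∫ x in Ω, η x • G x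

/-- `f` is the weak divergence of `σ` in `Ω`. -/
def IsWeakDivergence {d : ℕ} (Ω : Set (Space d)) (σ : L2Vec Ω) (f : L2 Ω) : Prop :=
  ∀ η : Space d → ℝ, IsTestFunction Ω η →
    ∫ x in Ω, inner ℝ (σ x) (∇ η x) = -∫ x in Ω, η x * f x

section TestFunction

variable {d : ℕ} {Ω : Set (Space d)} {η : Space d → ℝ}

theorem IsTestFunction.continuous_gradient (hη : IsTestFunction Ω η) :
    Continuous (fun x => ∇ η x) :=
  (InnerProductSpace.toDual ℝ (Space d)).symm.continuous.comp
    (hη.smooth.continuous_fderiv (by simp))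

theorem IsTestFunction.memLp (hη : IsTestFunction Ω η) (p : ENNReal) :
    MemLp η p (volume.restrict Ω) :=
  (hη.smooth.continuous.memLp_of_hasCompactSupport hη.hasCompactSupport).restrict Ω

theorem IsTestFunction.memLp_gradient (hη : IsTestFunction Ω η) (p : ENNReal) :
    MemLp (fun x => ∇ η x) p (volume.restrict Ω) := by
  refine (hη.continuous_gradient.memLp_of_hasCompactSupport ?_).restrict Ω
  exact (hη.hasCompactSupport.fderiv (𝕜 := ℝ)).comp_left
    (g := (InnerProductSpace.toDual ℝ (Space d)).symm) (map_zero _)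

theorem IsTestFunction.integrable_smul_gradient (hη : IsTestFunction Ω η) (φ : L2 Ω) :
    Integrable (fun x => φ x • ∇ η x) (volume.restrict Ω) :=
  memLp_one_iff_integrable.1 ((hη.memLp_gradient 2).smul (Lp.memLp φ))

theorem IsTestFunction.integrable_smul (hη : IsTestFunction Ω η) (G : L2Vec Ω) :
    Integrable (fun x => η x • G x) (volume.restrict Ω) :=
  memLp_one_iff_integrable.1 ((Lp.memLp G).smul (hη.memLp 2))

theorem IsTestFunction.integrable_mul (hη : IsTestFunction Ω η) (f : L2 Ω) :
    Integrable (fun x => η x * f x) (volume.restrict Ω) :=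
  (hη.memLp 2).integrable_mul (Lp.memLp f)

theorem IsTestFunction.integrable_inner_gradient (hη : IsTestFunction Ω η) (σ : L2Vec Ω) :
    Integrable (fun x => inner ℝ (σ x) (∇ η x)) (volume.restrict Ω) :=
  memLp_one_iff_integrable.1 <| MemLp.of_bilin (p := 2) (q := 2) (r := 1)
    (fun a b : Space d => inner ℝ a b) 1 (Lp.memLp σ) (hη.memLp_gradient 2)
    ((Lp.memLp σ).1.inner (hη.memLp_gradient 2).1)
    (Filter.Eventually.of_forall fun x => by
      simpa using nnnorm_inner_le_nnnorm (𝕜 := ℝ) (σ x) (∇ η x))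

end TestFunction

/-- The Sobolev space `H¹(Ω)`: functions `φ ∈ L²(Ω)` that possess a weak gradient in `L²(Ω)`.
An element is stored together with its weak gradient, as the pair `(φ, ∇φ)`; for open `Ω` the
second entry is determined by the first. -/
def H1 {d : ℕ} (Ω : Set (Space d)) : Submodule ℝ (L2 Ω × L2Vec Ω) where
  carrier := {p | IsWeakGradient Ω p.1 p.2}
  zero_mem' := by
    intro η _
    have h1 : (fun x => ((0 : L2 Ω) : Space d → ℝ) x • ∇ η x) =ᵐ[volume.restrict Ω] 0 := by
      filter_upwards [Lp.coeFn_zero ℝ 2 (volume.restrict Ω)] with x hx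
      simp only [hx, Pi.zero_apply, zero_smul]
    have h2 : (fun x => η x • ((0 : L2Vec Ω) : Space d → Space d) x)
        =ᵐ[volume.restrict Ω] 0 := by
      filter_upwards [Lp.coeFn_zero (Space d) 2 (volume.restrict Ω)] with x hx
      simp only [hx, Pi.zero_apply, smul_zero]
    simp only [Prod.fst_zero, Prod.snd_zero]
    rw [integral_congr_ae h1, integral_congr_ae h2]
    simp
  add_mem' := by
    intro p q hp hq η hη
    have h1 : (fun x => (p.1 + q.1 : L2 Ω) x • ∇ η x) =ᵐ[volume.restrict Ω]
        fun x => p.1 x • ∇ η x + q.1 x • ∇ η x := by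
      filter_upwards [Lp.coeFn_add p.1 q.1] with x hx
      simp only [hx, Pi.add_apply, add_smul]
    have h2 : (fun x => η x • (p.2 + q.2 : L2Vec Ω) x) =ᵐ[volume.restrict Ω]
        fun x => η x • p.2 x + η x • q.2 x := by
      filter_upwards [Lp.coeFn_add p.2 q.2] with x hx
      simp only [hx, Pi.add_apply, smul_add]
    simp only [Prod.fst_add, Prod.snd_add]
    rw [integral_congr_ae h1, integral_congr_ae h2,
      integral_add (hη.integrable_smul_gradient _) (hη.integrable_smul_gradient _),
      integral_add (hη.integrable_smul _) (hη.integrable_smul _), hp η hη, hq η hη, neg_add]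
  smul_mem' := by
    intro c p hp η hη
    have h1 : (fun x => (c • p.1 : L2 Ω) x • ∇ η x) =ᵐ[volume.restrict Ω]
        fun x => c • (p.1 x • ∇ η x) := by
      filter_upwards [Lp.coeFn_smul c p.1] with x hx
      simp [hx, smul_smul]
    have h2 : (fun x => η x • (c • p.2 : L2Vec Ω) x) =ᵐ[volume.restrict Ω]
        fun x => c • (η x • p.2 x) := by
      filter_upwards [Lp.coeFn_smul c p.2] with x hx
      simp [hx, smul_smul, mul_comm]
    simp only [Prod.smul_fst, Prod.smul_snd]
    rw [integral_congr_ae h1, integral_congr_ae h2, integral_smul, integral_smul, hp η hη,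
      smul_neg]

/-- The space `H(div, Ω)`: vector fields `σ ∈ L²(Ω)` that possess a weak divergence in `L²(Ω)`.
An element is stored together with its weak divergence, as the pair `(σ, div σ)`; for open `Ω`
the second entry is determined by the first. -/
def HDiv {d : ℕ} (Ω : Set (Space d)) : Submodule ℝ (L2Vec Ω × L2 Ω) where
  carrier := {p | IsWeakDivergence Ω p.1 p.2}
  zero_mem' := by
    intro η _
    have h1 : (fun x => inner ℝ (((0 : L2Vec Ω) : Space d → Space d) x) (∇ η x))
        =ᵐ[volume.restrict Ω] 0 := by
      filter_upwards [Lp.coeFn_zero (Space d) 2 (volume.restrict Ω)] with x hx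
      simp only [hx, Pi.zero_apply, inner_zero_left]
    have h2 : (fun x => η x * ((0 : L2 Ω) : Space d → ℝ) x) =ᵐ[volume.restrict Ω] 0 := by
      filter_upwards [Lp.coeFn_zero ℝ 2 (volume.restrict Ω)] with x hx
      simp only [hx, Pi.zero_apply, mul_zero]
    simp only [Prod.fst_zero, Prod.snd_zero]
    rw [integral_congr_ae h1, integral_congr_ae h2]
    simp
  add_mem' := by
    intro p q hp hq η hη
    have h1 : (fun x => inner ℝ ((p.1 + q.1 : L2Vec Ω) x) (∇ η x)) =ᵐ[volume.restrict Ω]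
        fun x => inner ℝ (p.1 x) (∇ η x) + inner ℝ (q.1 x) (∇ η x) := by
      filter_upwards [Lp.coeFn_add p.1 q.1] with x hx
      simp only [hx, Pi.add_apply, inner_add_left]
    have h2 : (fun x => η x * (p.2 + q.2 : L2 Ω) x) =ᵐ[volume.restrict Ω]
        fun x => η x * p.2 x + η x * q.2 x := by
      filter_upwards [Lp.coeFn_add p.2 q.2] with x hx
      simp only [hx, Pi.add_apply, mul_add]
    simp only [Prod.fst_add, Prod.snd_add]
    rw [integral_congr_ae h1, integral_congr_ae h2,
      integral_add (hη.integrable_inner_gradient _) (hη.integrable_inner_gradient _),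
      integral_add (hη.integrable_mul _) (hη.integrable_mul _), hp η hη, hq η hη, neg_add]
  smul_mem' := by
    intro c p hp η hη
    have h1 : (fun x => inner ℝ ((c • p.1 : L2Vec Ω) x) (∇ η x)) =ᵐ[volume.restrict Ω]
        fun x => c * inner ℝ (p.1 x) (∇ η x) := by
      filter_upwards [Lp.coeFn_smul c p.1] with x hx
      simp only [hx, Pi.smul_apply, real_inner_smul_left]
    have h2 : (fun x => η x * (c • p.2 : L2 Ω) x) =ᵐ[volume.restrict Ω]
        fun x => c * (η x * p.2 x) := by
      filter_upwards [Lp.coeFn_smul c p.2] with x hx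
      simp [hx, mul_left_comm]
    simp only [Prod.smul_fst, Prod.smul_snd]
    rw [integral_congr_ae h1, integral_congr_ae h2, integral_const_mul, integral_const_mul,
      hp η hη, mul_neg]

/-- The function `φ ∈ L²(Ω)` underlying an element of `H¹(Ω)`. -/
def fn {d : ℕ} {Ω : Set (Space d)} (φ : H1 Ω) : L2 Ω := φ.1.1

/-- The weak gradient `∇φ ∈ L²(Ω)` of `φ ∈ H¹(Ω)`. -/
def grad {d : ℕ} {Ω : Set (Space d)} (φ : H1 Ω) : L2Vec Ω := φ.1.2

/-- The vector field `σ ∈ L²(Ω)` underlying an element of `H(div, Ω)`. -/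
def field {d : ℕ} {Ω : Set (Space d)} (σ : HDiv Ω) : L2Vec Ω := σ.1.1

/-- The weak divergence `div σ ∈ L²(Ω)` of `σ ∈ H(div, Ω)`. -/
def div {d : ℕ} {Ω : Set (Space d)} (σ : HDiv Ω) : L2 Ω := σ.1.2

/-- `Δφ = 0` in `Ω`, weakly: `∇φ` has the weak divergence `0`. -/
def IsHarmonic {d : ℕ} {Ω : Set (Space d)} (φ : H1 Ω) : Prop :=
  IsWeakDivergence Ω (grad φ) 0

/-- The triples `(η|_Ω, ∇η|_Ω, η|_Γ)` for `η ∈ C^∞(ℝ^d)`. -/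
def smoothTraceGraph {d : ℕ} (Ω : Set (Space d)) :
    Submodule ℝ (L2 Ω × L2Vec Ω × L2Bdry Ω) where
  carrier := {p | ∃ η : Space d → ℝ, ContDiff ℝ (⊤ : ℕ∞) η ∧ p.1 =ᵐ[volume.restrict Ω] η ∧
    p.2.1 =ᵐ[volume.restrict Ω] (fun x => ∇ η x) ∧ p.2.2 =ᵐ[surface Ω] η}
  zero_mem' := by
    refine ⟨fun _ => 0, contDiff_const, Lp.coeFn_zero _ _ _, ?_, Lp.coeFn_zero _ _ _⟩
    filter_upwards [Lp.coeFn_zero (Space d) 2 (volume.restrict Ω)] with x hx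
    simpa [gradient_fun_const] using hx
  add_mem' := by
    rintro p q ⟨η, hη, h1, h2, h3⟩ ⟨ζ, hζ, k1, k2, k3⟩
    refine ⟨η + ζ, hη.add hζ, ?_, ?_, ?_⟩
    · filter_upwards [Lp.coeFn_add p.1 q.1, h1, k1] with x hx hx1 hx2
      simp only [Prod.fst_add, hx, Pi.add_apply, hx1, hx2]
    · filter_upwards [Lp.coeFn_add p.2.1 q.2.1, h2, k2] with x hx hx1 hx2
      have hd1 : DifferentiableAt ℝ η x := (hη.differentiable (by simp)).differentiableAt
      have hd2 : DifferentiableAt ℝ ζ x := (hζ.differentiable (by simp)).differentiableAt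
      simp only [Prod.snd_add, Prod.fst_add, hx, Pi.add_apply, hx1, hx2]
      simp [gradient, fderiv_add hd1 hd2]
    · filter_upwards [Lp.coeFn_add p.2.2 q.2.2, h3, k3] with x hx hx1 hx2
      simp only [Prod.snd_add, hx, Pi.add_apply, hx1, hx2]
  smul_mem' := by
    rintro c p ⟨η, hη, h1, h2, h3⟩
    refine ⟨c • η, contDiff_const.smul hη, ?_, ?_, ?_⟩
    · filter_upwards [Lp.coeFn_smul c p.1, h1] with x hx hx1
      simp [hx, hx1]
    · filter_upwards [Lp.coeFn_smul c p.2.1, h2] with x hx hx1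
      have hd1 : DifferentiableAt ℝ η x := (hη.differentiable (by simp)).differentiableAt
      simp only [Prod.smul_snd, Prod.smul_fst, hx, Pi.smul_apply, hx1]
      simp [gradient, fderiv_const_smul hd1]
    · filter_upwards [Lp.coeFn_smul c p.2.2, h3] with x hx hx1
      simp [hx, hx1]

/-- `f ∈ L²(Γ)` is the trace of `φ ∈ H¹(Ω)`: there are `η_n ∈ C^∞(ℝ^d)` with `η_n → φ` in `H¹(Ω)`
and `η_n|_Γ → f` in `L²(Γ)`. In other words, the trace operator `H¹(Ω) → L²(Γ)` is the closure of
the restriction map `η|_Ω ↦ η|_Γ` on smooth functions. -/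
def HasTrace {d : ℕ} {Ω : Set (Space d)} (φ : H1 Ω) (f : L2Bdry Ω) : Prop :=
  (fn φ, grad φ, f) ∈ (smoothTraceGraph Ω).topologicalClosure

/-- The trace space `H^{1/2}(Γ) = {φ|_Γ : φ ∈ H¹(Ω)}`, a linear subspace of `L²(Γ)`. -/
def HHalf {d : ℕ} (Ω : Set (Space d)) : Submodule ℝ (L2Bdry Ω) where
  carrier := {f | ∃ φ : H1 Ω, HasTrace φ f}
  zero_mem' := ⟨0, (smoothTraceGraph Ω).topologicalClosure.zero_mem⟩
  add_mem' := by
    rintro f g ⟨φ, hφ⟩ ⟨ψ, hψ⟩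
    exact ⟨φ + ψ, (smoothTraceGraph Ω).topologicalClosure.add_mem hφ hψ⟩
  smul_mem' := by
    rintro c f ⟨φ, hφ⟩
    exact ⟨c • φ, (smoothTraceGraph Ω).topologicalClosure.smul_mem c hφ⟩

theorem mem_HHalf {d : ℕ} {Ω : Set (Space d)} {f : L2Bdry Ω} :
    f ∈ HHalf Ω ↔ ∃ φ : H1 Ω, HasTrace φ f := Iff.rfl

open Classical in
/-- The trace operator `H¹(Ω) → H^{1/2}(Γ)`, `φ ↦ φ|_Γ`. -/
def trace {d : ℕ} {Ω : Set (Space d)} (φ : H1 Ω) : HHalf Ω :=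
  if h : ∃ f : L2Bdry Ω, HasTrace φ f then
    ⟨Classical.choose h, mem_HHalf.2 ⟨φ, Classical.choose_spec h⟩⟩
  else 0

/-- Some `φ ∈ H¹(Ω)` with `φ|_Γ = ψ`. -/
def lift {d : ℕ} {Ω : Set (Space d)} (ψ : HHalf Ω) : H1 Ω :=
  Classical.choose (mem_HHalf.1 ψ.2)

/-- The normal trace `n·σ|_Γ` of `σ ∈ H(div, Ω)` as a functional on `H^{1/2}(Γ)`, given by the
Green formula `⟨φ|_Γ, n·σ|_Γ⟩ = (∇φ, σ)_{L²(Ω)} + (φ, div σ)_{L²(Ω)}` for `φ ∈ H¹(Ω)`. On a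
bounded Lipschitz domain the right-hand side depends on `φ|_Γ` only. -/
def normalTrace {d : ℕ} {Ω : Set (Space d)} (σ : HDiv Ω) (ψ : HHalf Ω) : ℝ :=
  inner ℝ (grad (lift ψ)) (field σ) + inner ℝ (fn (lift ψ)) (div σ)

/-- `u ∈ H¹(Ω)` solves the Dirichlet problem `Δu = 0` in `Ω`, `u = g` on `Γ`. -/
def IsDirichletSolution {d : ℕ} {Ω : Set (Space d)} (g : HHalf Ω) (u : H1 Ω) : Prop :=
  IsHarmonic u ∧ trace u = g

/-- `(τ, ω) ∈ H(div, Ω) × L²(Ω)` solves the mixed problem with boundary datum `f`: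
`(τ, σ) + (div σ, ω) = ⟨f, n·σ|_Γ⟩` and `(div τ, ψ) = 0` for all
`(σ, ψ) ∈ H(div, Ω) × L²(Ω)`. -/
def IsMixedSolution {d : ℕ} {Ω : Set (Space d)} (f : HHalf Ω) (τ : HDiv Ω) (ω : L2 Ω) : Prop :=
  ∀ (σ : HDiv Ω) (ψ : L2 Ω),
    inner ℝ (field τ) (field σ) + inner ℝ (div σ) ω = normalTrace σ f ∧
      inner ℝ (div τ) ψ = 0

/-- The minorant `2 ⟨f, n·τ|_Γ⟩ - ‖τ‖²`, with `f = g - v|_Γ`. -/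
def minorant {d : ℕ} {Ω : Set (Space d)} (f : HHalf Ω) (τ : HDiv Ω) : ℝ :=
  2 * normalTrace τ f - ‖field τ‖ ^ 2

/-- The majorant `‖∇w‖²`. -/
def majorant {d : ℕ} {Ω : Set (Space d)} (w : H1 Ω) : ℝ :=
  ‖grad w‖ ^ 2

/-- `a` is the unique maximiser of `F` over `S`. -/
def IsUniqueMaximiser {α : Type*} (F : α → ℝ) (S : Set α) (a : α) : Prop :=
  a ∈ S ∧ ∀ b ∈ S, b ≠ a → F b < F a

/-- `a` is the unique minimiser of `F` over `S`. -/
def IsUniqueMinimiser {α : Type*} (F : α → ℝ) (S : Set α) (a : α) : Prop :=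
  a ∈ S ∧ ∀ b ∈ S, b ≠ a → F a < F b

end FunctionalBEM

end

namespace FunctionalBEM

open MeasureTheory Topology Set
open scoped Gradient

/-! Everything is a statement about one function, w = u - v, which is harmonic with trace g - v|_Γ.
Green's formula has two consequences: ∇w is orthogonal in L²(Ω) to the gradients of H¹₀(Ω), and
⟨w|_Γ, n·σ⟩ = (∇w, σ) whenever div σ = 0. Completing the square turns the minorant into ‖∇w‖² - ‖∇w
- σ‖². If w' has the trace of w, then w' - w lies in H¹₀(Ω), and Pythagoras gives ‖∇w'‖² = ‖∇w‖² +
‖∇(w' - w)‖². Both extremal properties can be read off. The first mixed equation for (∇w, w) is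
Green's formula itself, and uniqueness of ω holds because divergences are dense in L²(Ω)
(`eq_zero_of_forall_inner_div`). The Dirichlet solution is any lift of g minus the element of H¹₀(Ω)
whose gradient is the orthogonal projection of the gradient of the lift. Poincaré's inequality makes
the space of these gradients closed (`exists_mem_H10_inner_eq_zero`).

The labour lies in the trace. It must exist (`exists_hasTrace`), be unique (`HasTrace.unique`), and
vanish only on H¹₀(Ω), the closure of the test functions (`mem_H10_of_hasTrace_zero`). Existence
follows from density of smooth functions in H¹(Ω) and the trace inequality. For the kernel, the
boundary term in ∫_Ω ∂_ξ(κη) is bounded by the L²(Γ) norm of η. In the limit, zero trace means that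
the extension by zero has a weak gradient on all of ℝ^d.

Both density results localise by a partition of unity and mollify with a density centred at a small
multiple of the vertical direction instead of the origin. Shifting one way, the mollifier samples
only points of Ω; shifting the other way, it moves the support into Ω.

Surface integrals are handled without an area formula or a normal vector. The graph map and the
projection are Lipschitz, so surface measure is comparable to Lebesgue measure on the hyperplane.
The divergence theorem on a subgraph is exact in the vertical direction. In other directions an
inequality suffices, obtained by translating the subgraph. -/

/-- Jensen's inequality for the averaging of translates against a probability density. -/
theorem enorm_integral_smul_sq_le {V E : Type*} [TopologicalSpace V] [MeasurableSpace V]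
    [BorelSpace V] {μ : Measure V} [NormedAddCommGroup E] [NormedSpace ℝ E] {ρ : V → ℝ}
    (hρ : Continuous ρ) (h0 : ∀ x, 0 ≤ ρ x)
    (h1 : ∫ x, ρ x ∂μ = 1) {u : V → E} (hu : AEStronglyMeasurable u μ) :
    ‖∫ t, ρ t • u t ∂μ‖ₑ ^ 2 ≤ ∫⁻ t, ENNReal.ofReal (ρ t) * ‖u t‖ₑ ^ 2 ∂μ := by
  have hint : Integrable ρ μ := by
    by_contra h
    simp [integral_undef h] at h1
  have hmeas : Measurable fun t => ENNReal.ofReal (ρ t) := hρ.measurable.ennreal_ofReal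
  -- Against the probability measure ρ dμ the inequality is ‖u‖₁ ≤ ‖u‖₂.
  have hprob : IsProbabilityMeasure (μ.withDensity fun t => ENNReal.ofReal (ρ t)) := by
    constructor
    rw [withDensity_apply _ MeasurableSet.univ, Measure.restrict_univ,
      ← ofReal_integral_eq_lintegral_ofReal hint (Filter.Eventually.of_forall h0), h1]
    simp
  have hac := withDensity_absolutelyContinuous μ fun t => ENNReal.ofReal (ρ t)
  have hJ := eLpNorm_le_eLpNorm_of_exponent_le (p := 1) (q := 2) (by norm_num)
    (hu.mono_ac hac)
  have hsq : eLpNorm u 2 (μ.withDensity fun t => ENNReal.ofReal (ρ t)) ^ 2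
      = ∫⁻ t, ENNReal.ofReal (ρ t) * ‖u t‖ₑ ^ 2 ∂μ := by
    have := eLpNorm_nnreal_pow_eq_lintegral (f := u) (p := 2)
      (μ := μ.withDensity fun t => ENNReal.ofReal (ρ t)) (by norm_num)
    norm_cast at this
    simp only [ENNReal.rpow_ofNat] at this
    refine Eq.trans this ?_
    rw [lintegral_withDensity_eq_lintegral_mul_non_measurable _ hmeas (by simp)]
    rfl
  rw [← hsq]
  refine pow_le_pow_left₀ (by simp) (le_trans ?_ hJ) 2
  rw [eLpNorm_one_eq_lintegral_enorm,
    lintegral_withDensity_eq_lintegral_mul_non_measurable _ hmeas (by simp)]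
  refine (enorm_integral_le_lintegral_enorm _).trans (lintegral_mono fun t => ?_)
  simp only [enorm_smul, Pi.mul_apply, Real.enorm_of_nonneg (h0 t), le_refl]

/-! ### Mollification in L² -/

section Mollifier

variable {V E : Type*} [NormedAddCommGroup V] [NormedSpace ℝ V] [FiniteDimensional ℝ V]
  [MeasurableSpace V] [BorelSpace V] {μ : Measure V} [μ.IsAddHaarMeasure]
  [NormedAddCommGroup E]

/-- Translations preserve Haar measure and depend continuously on t in the compact-open topology,
and composition with a measure-preserving map is continuous in L² with respect to that map. -/
theorem tendsto_eLpNorm_translate_sub {f : V → E} (hf : MemLp f 2 μ) :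
    Filter.Tendsto (fun t : V => eLpNorm (fun x => f (x - t) - f x) 2 μ) (𝓝 0) (𝓝 0) := by
  let g : C(V, C(V, V)) := (ContinuousMap.mk (fun a : V × V => a.2 - a.1)
    (by fun_prop)).curry
  have hg : ∀ t x, g t x = x - t := fun _ _ => rfl
  have hmp : ∀ t : V, MeasurePreserving (g t) μ μ := fun t =>
    measurePreserving_sub_right μ t
  have h1 : Continuous fun t : V =>
      Lp.compMeasurePreserving (p := 2) (g t) (hmp t) (hf.toLp f) :=
    Continuous.compMeasurePreservingLp (p := 2) continuous_const g.continuous hmp (by simp)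
  have h2 := tendsto_iff_edist_tendsto_0.1 (h1.tendsto 0)
  refine h2.congr fun t => ?_
  rw [Lp.toLp_compMeasurePreserving, Lp.toLp_compMeasurePreserving, Lp.edist_toLp_toLp]
  refine congrArg (fun u => eLpNorm u 2 μ) (funext fun x => ?_)
  simp [hg]

/-- Convolution with a probability density supported near the origin is close to the identity
in `L²`. -/
theorem exists_eLpNorm_convolution_sub_le [NormedSpace ℝ E] [CompleteSpace E] {f : V → E}
    (hf : MemLp f 2 μ) {ε : ENNReal}
    (hε : 0 < ε) :
    ∃ δ > 0, ∀ ρ : V → ℝ, Continuous ρ → (∀ x, 0 ≤ ρ x) → Function.support ρ ⊆ Metric.ball 0 δ →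
      ∫ x, ρ x ∂μ = 1 →
      eLpNorm (fun x => (∫ t, ρ t • f (x - t) ∂μ) - f x) 2 μ ≤ ε := by
  have h := (tendsto_eLpNorm_translate_sub hf).eventually (Iic_mem_nhds hε)
  obtain ⟨δ, hδ, hball⟩ := Metric.eventually_nhds_iff_ball.1 h
  refine ⟨δ, hδ, fun ρ hρ h0 hsupp h1 => ?_⟩
  have hint : Integrable ρ μ := by
    by_contra h
    simp [integral_undef h] at h1
  have hcs : HasCompactSupport ρ :=
    HasCompactSupport.of_support_subset_isCompact (isCompact_closedBall 0 δ)
      (hsupp.trans Metric.ball_subset_closedBall)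
  have hex := hcs.convolutionExists_left (ContinuousLinearMap.lsmul ℝ ℝ) (μ := μ) hρ
    (hf.locallyIntegrable (by norm_num))
  -- Since ρ has integral 1, the value f x may be moved under the integral.
  have hpt : ∀ x, (∫ t, ρ t • f (x - t) ∂μ) - f x = ∫ t, ρ t • (f (x - t) - f x) ∂μ := by
    intro x
    simp only [smul_sub]
    rw [integral_sub (show Integrable (fun t => ρ t • f (x - t)) μ from hex x)
      (hint.smul_const _), integral_smul_const, h1, one_smul]
  have hsm := hf.aestronglyMeasurable
  have hj : AEStronglyMeasurable (fun p : V × V => f (p.1 - p.2) - f p.1) (μ.prod μ) :=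
    (hsm.comp_quasiMeasurePreserving
      (quasiMeasurePreserving_sub_of_right_invariant μ μ)).sub hsm.comp_fst
  have hmul : AEMeasurable (Function.uncurry fun x t : V =>
      ENNReal.ofReal (ρ t) * ‖f (x - t) - f x‖ₑ ^ 2) (μ.prod μ) :=
    ((hρ.measurable.comp measurable_snd).ennreal_ofReal.aemeasurable).mul
      (hj.enorm.pow_const 2)
  have hsq : ∀ u : V → E, eLpNorm u 2 μ ^ 2 = ∫⁻ t, ‖u t‖ₑ ^ 2 ∂μ := by
    intro u
    have := eLpNorm_nnreal_pow_eq_lintegral (f := u) (p := 2) (μ := μ) (by norm_num)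
    norm_cast at this
    simpa only [ENNReal.rpow_ofNat] using this
  have hkey : eLpNorm (fun x => (∫ t, ρ t • f (x - t) ∂μ) - f x) 2 μ ^ 2 ≤ ε ^ 2 := by
    rw [hsq]
    calc ∫⁻ x, ‖(∫ t, ρ t • f (x - t) ∂μ) - f x‖ₑ ^ 2 ∂μ
        ≤ ∫⁻ x, ∫⁻ t, ENNReal.ofReal (ρ t) * ‖f (x - t) - f x‖ₑ ^ 2 ∂μ ∂μ := by
          refine lintegral_mono fun x => ?_
          rw [hpt x]
          refine enorm_integral_smul_sq_le hρ h0 h1 (AEStronglyMeasurable.sub ?_ (by fun_prop))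
          exact hsm.comp_quasiMeasurePreserving
            (quasiMeasurePreserving_sub_left_of_right_invariant μ x)
      -- After the exchange, the inner integral is the squared L² distance of f from its translate
      -- by t, and only t in the ball of radius δ carry weight.
      _ = ∫⁻ t, ∫⁻ x, ENNReal.ofReal (ρ t) * ‖f (x - t) - f x‖ₑ ^ 2 ∂μ ∂μ :=
          lintegral_lintegral_swap hmul
      _ ≤ ∫⁻ t, ENNReal.ofReal (ρ t) * ε ^ 2 ∂μ := by
          refine lintegral_mono fun t => ?_
          rw [lintegral_const_mul' _ _ ENNReal.ofReal_ne_top]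
          by_cases ht : ρ t = 0
          · simp [ht]
          · gcongr
            rw [← hsq]
            exact pow_le_pow_left₀ (by simp) (hball t (hsupp ht)) 2
      _ = ε ^ 2 := by
          rw [lintegral_mul_const _ hρ.measurable.ennreal_ofReal,
            ← ofReal_integral_eq_lintegral_ofReal hint (Filter.Eventually.of_forall h0), h1]
          simp
  exact (ENNReal.pow_le_pow_left_iff two_ne_zero).1 hkey

end Mollifier

/-! ### Test functions, weak derivatives, H¹₀ and Poincaré's inequality -/

section TestFunction

variable {d : ℕ} {Ω Ω' : Set (Space d)} {η κ : Space d → ℝ}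

theorem IsTestFunction.mono (hη : IsTestFunction Ω η) (h : Ω ⊆ Ω') : IsTestFunction Ω' η :=
  ⟨hη.smooth, hη.hasCompactSupport, hη.tsupport_subset.trans h⟩

theorem IsTestFunction.differentiable (hη : IsTestFunction Ω η) : Differentiable ℝ η :=
  hη.smooth.differentiable (by simp)

theorem IsTestFunction.continuous (hη : IsTestFunction Ω η) : Continuous η :=
  hη.smooth.continuous

theorem gradient_add {f g : Space d → ℝ} {x : Space d} (hf : DifferentiableAt ℝ f x)
    (hg : DifferentiableAt ℝ g x) : ∇ (f + g) x = ∇ f x + ∇ g x := by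
  simp [gradient, fderiv_add hf hg]

theorem gradient_const_smul {f : Space d → ℝ} {x : Space d} (hf : DifferentiableAt ℝ f x)
    (c : ℝ) : ∇ (c • f) x = c • ∇ f x := by
  simp [gradient, fderiv_const_smul hf]

theorem gradient_mul {f g : Space d → ℝ} {x : Space d} (hf : DifferentiableAt ℝ f x)
    (hg : DifferentiableAt ℝ g x) :
    ∇ (fun y => f y * g y) x = f x • ∇ g x + g x • ∇ f x := by
  simp [gradient, fderiv_fun_mul hf hg]

theorem gradient_eq_zero_of_notMem_tsupport {f : Space d → ℝ} {x : Space d}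
    (hx : x ∉ tsupport f) : ∇ f x = 0 := by
  have : fderiv ℝ f x = 0 := by
    by_contra h
    exact hx (support_fderiv_subset ℝ h)
  simp [gradient, this]

theorem continuous_gradient {f : Space d → ℝ} (hf : ContDiff ℝ 1 f) :
    Continuous fun x => ∇ f x :=
  (InnerProductSpace.toDual ℝ (Space d)).symm.continuous.comp
    (hf.continuous_fderiv (by simp))

theorem IsTestFunction.add (hη : IsTestFunction Ω η) (hκ : IsTestFunction Ω κ) :
    IsTestFunction Ω (η + κ) :=
  ⟨hη.smooth.add hκ.smooth, hη.hasCompactSupport.add hκ.hasCompactSupport,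
    (tsupport_add η κ).trans (union_subset hη.tsupport_subset hκ.tsupport_subset)⟩

theorem IsTestFunction.const_smul (hη : IsTestFunction Ω η) (c : ℝ) :
    IsTestFunction Ω (c • η) :=
  ⟨contDiff_const.smul hη.smooth, hη.hasCompactSupport.smul_left (f := fun _ => c),
    (tsupport_smul_subset_right (fun _ => c) η).trans hη.tsupport_subset⟩

theorem IsTestFunction.mul_left (hη : IsTestFunction Ω η) {f : Space d → ℝ}
    (hf : ContDiff ℝ (⊤ : ℕ∞) f) : IsTestFunction Ω (fun x => f x * η x) :=
  ⟨hf.mul hη.smooth, hη.hasCompactSupport.mul_left,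
    (tsupport_mul_subset_right (f := f) (g := η)).trans hη.tsupport_subset⟩

theorem IsTestFunction.setIntegral_eq {E : Type*} [NormedAddCommGroup E] [NormedSpace ℝ E]
    (hη : IsTestFunction Ω η) {F : Space d → E} (hF : ∀ x ∉ tsupport η, F x = 0) :
    ∫ x in Ω, F x = ∫ x, F x :=
  setIntegral_eq_integral_of_forall_compl_eq_zero fun x hx =>
    hF x fun h => hx (hη.tsupport_subset h)

/-- Integration by parts on `ℝ^d` for functions one of which has compact support. -/
theorem integral_mul_inner_gradient {f g : Space d → ℝ} (hf : ContDiff ℝ 1 f)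
    (hg : ContDiff ℝ 1 g) (hg' : HasCompactSupport g) (a : Space d) :
    ∫ x, f x * inner ℝ (∇ g x) a = -∫ x, inner ℝ (∇ f x) a * g x := by
  simp only [inner_gradient_left]
  have hf1 : Continuous fun x => fderiv ℝ f x a := (hf.continuous_fderiv (by simp)).clm_apply
    continuous_const
  have hg1 : Continuous fun x => fderiv ℝ g x a := (hg.continuous_fderiv (by simp)).clm_apply
    continuous_const
  refine integral_mul_fderiv_eq_neg_fderiv_mul_of_integrable ?_ ?_ ?_
    (fun x _ => hf.differentiable (by simp) x) (fun x _ => hg.differentiable (by simp) x)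
  · exact (hf1.mul hg.continuous).integrable_of_hasCompactSupport hg'.mul_left
  · exact (hf.continuous.mul hg1).integrable_of_hasCompactSupport
      ((hg'.fderiv_apply (𝕜 := ℝ) a).mul_left)
  · exact (hf.continuous.mul hg.continuous).integrable_of_hasCompactSupport hg'.mul_left

theorem IsTestFunction.memLp_inner_gradient (hη : IsTestFunction Ω' η) (a : Space d)
    (p : ENNReal) : MemLp (fun x => inner ℝ (∇ η x) a) p (volume.restrict Ω) := by
  simp only [inner_gradient_left]
  exact (((hη.smooth.continuous_fderiv (by simp)).clm_apply
    continuous_const).memLp_of_hasCompactSupport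
      (hη.hasCompactSupport.fderiv_apply (𝕜 := ℝ) a)).restrict Ω

theorem IsTestFunction.memLp_smul_const (hη : IsTestFunction Ω' η) (a : Space d)
    (p : ENNReal) : MemLp (fun x => η x • a) p (volume.restrict Ω) :=
  ((hη.continuous.smul continuous_const).memLp_of_hasCompactSupport
    hη.hasCompactSupport.smul_right).restrict Ω

theorem IsTestFunction.integrable_smul_gradient' (hη : IsTestFunction Ω' η) (φ : L2 Ω) :
    Integrable (fun x => φ x • ∇ η x) (volume.restrict Ω) :=
  have h : MemLp (fun x => ∇ η x) 2 (volume.restrict Ω) :=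
    (hη.continuous_gradient.memLp_of_hasCompactSupport
      (HasCompactSupport.intro hη.hasCompactSupport fun _ hx =>
        gradient_eq_zero_of_notMem_tsupport hx)).restrict Ω
  memLp_one_iff_integrable.1 (h.smul (Lp.memLp φ))

theorem IsTestFunction.integrable_smul' (hη : IsTestFunction Ω' η) (G : L2Vec Ω) :
    Integrable (fun x => η x • G x) (volume.restrict Ω) :=
  have h : MemLp η 2 (volume.restrict Ω) :=
    (hη.continuous.memLp_of_hasCompactSupport hη.hasCompactSupport).restrict Ω
  memLp_one_iff_integrable.1 ((Lp.memLp G).smul h)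

/-- The defining identity of the weak gradient, tested against `η`, expressed through inner
products in `L²`. -/
theorem integral_smul_gradient_eq_iff (hη : IsTestFunction Ω' η) (φ : L2 Ω) (G : L2Vec Ω) :
    ∫ x in Ω, φ x • ∇ η x = -∫ x in Ω, η x • G x ↔
      ∀ a : Space d, inner ℝ φ ((hη.memLp_inner_gradient (Ω := Ω) a 2).toLp _) =
        -inner ℝ G ((hη.memLp_smul_const (Ω := Ω) a 2).toLp _) := by
  have h1 : ∀ a : Space d, inner ℝ φ ((hη.memLp_inner_gradient (Ω := Ω) a 2).toLp _) =
      inner ℝ a (∫ x in Ω, φ x • ∇ η x) := by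
    intro a
    rw [L2.inner_def, ← integral_inner (hη.integrable_smul_gradient' φ)]
    refine integral_congr_ae ?_
    filter_upwards [(hη.memLp_inner_gradient (Ω := Ω) a 2).coeFn_toLp] with x hx
    rw [hx, real_inner_smul_right, real_inner_comm a]
    simp [mul_comm]
  have h2 : ∀ a : Space d, inner ℝ G ((hη.memLp_smul_const (Ω := Ω) a 2).toLp _) =
      inner ℝ a (∫ x in Ω, η x • G x) := by
    intro a
    rw [L2.inner_def, ← integral_inner (hη.integrable_smul' G)]
    refine integral_congr_ae ?_
    filter_upwards [(hη.memLp_smul_const (Ω := Ω) a 2).coeFn_toLp] with x hx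
    rw [hx, real_inner_smul_right, real_inner_smul_right, real_inner_comm a]
  simp only [h1, h2, ← inner_neg_right]
  exact ⟨fun h a => by rw [h], fun h => ext_inner_left ℝ h⟩

/-- Paired with each constant vector, the identity equates L² inner products, which are continuous
in the pair. -/
theorem isClosed_setOf_integral_smul_gradient_eq (hη : IsTestFunction Ω' η) :
    IsClosed {p : L2 Ω × L2Vec Ω | ∫ x in Ω, p.1 x • ∇ η x = -∫ x in Ω, η x • p.2 x} := by
  simp only [integral_smul_gradient_eq_iff hη, Set.ofPred_forall]
  exact isClosed_iInter fun a => isClosed_eq (by fun_prop) (by fun_prop)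

theorem isClosed_H1 : IsClosed (H1 Ω : Set (L2 Ω × L2Vec Ω)) := by
  have : (H1 Ω : Set (L2 Ω × L2Vec Ω)) = ⋂ (η : Space d → ℝ) (_ : IsTestFunction Ω η),
      {p | ∫ x in Ω, p.1 x • ∇ η x = -∫ x in Ω, η x • p.2 x} := by
    ext p
    simp only [mem_iInter]
    rfl
  rw [this]
  exact isClosed_iInter fun η => isClosed_iInter fun hη =>
    isClosed_setOf_integral_smul_gradient_eq hη

/-- In this form (σ, div σ) is orthogonal to every (∇η, η). Green's formula on H¹₀(Ω) and the
density of divergences both start from here. -/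
theorem isWeakDivergence_iff {σ : L2Vec Ω} {f : L2 Ω} :
    IsWeakDivergence Ω σ f ↔ ∀ η : Space d → ℝ, ∀ hη : IsTestFunction Ω η,
      inner ℝ ((hη.memLp_gradient 2).toLp _) σ + inner ℝ ((hη.memLp 2).toLp _) f = 0 := by
  refine forall₂_congr fun η hη => ?_
  have h1 : inner ℝ ((hη.memLp_gradient 2).toLp _) σ = ∫ x in Ω, inner ℝ (σ x) (∇ η x) := by
    rw [L2.inner_def]
    refine integral_congr_ae ?_
    filter_upwards [(hη.memLp_gradient 2).coeFn_toLp] with x hx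
    rw [hx, real_inner_comm]
  have h2 : inner ℝ ((hη.memLp 2).toLp _) f = ∫ x in Ω, η x * f x := by
    rw [L2.inner_def]
    refine integral_congr_ae ?_
    filter_upwards [(hη.memLp 2).coeFn_toLp] with x hx
    rw [hx]
    simp [mul_comm]
  rw [h1, h2, eq_neg_iff_add_eq_zero]

/-- The pairs `(η|_Ω, ∇η|_Ω)` for `η ∈ C_c^∞(Ω')`. -/
noncomputable def testGraph (Ω' Ω : Set (Space d)) : Submodule ℝ (L2 Ω × L2Vec Ω) where
  carrier := {p | ∃ η : Space d → ℝ, IsTestFunction Ω' η ∧ p.1 =ᵐ[volume.restrict Ω] η ∧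
    p.2 =ᵐ[volume.restrict Ω] fun x => ∇ η x}
  zero_mem' := by
    refine ⟨fun _ => 0, ⟨contDiff_const, HasCompactSupport.zero, by simp [tsupport]⟩,
      Lp.coeFn_zero _ _ _, ?_⟩
    filter_upwards [Lp.coeFn_zero (Space d) 2 (volume.restrict Ω)] with x hx
    simpa [gradient_fun_const] using hx
  add_mem' := by
    rintro p q ⟨η, hη, h1, h2⟩ ⟨ζ, hζ, k1, k2⟩
    refine ⟨η + ζ, hη.add hζ, ?_, ?_⟩
    · filter_upwards [Lp.coeFn_add p.1 q.1, h1, k1] with x hx hx1 hx2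
      simp only [Prod.fst_add, hx, Pi.add_apply, hx1, hx2]
    · filter_upwards [Lp.coeFn_add p.2 q.2, h2, k2] with x hx hx1 hx2
      rw [gradient_add (hη.differentiable x) (hζ.differentiable x), ← hx1, ← hx2]
      exact hx
  smul_mem' := by
    rintro c p ⟨η, hη, h1, h2⟩
    refine ⟨c • η, hη.const_smul c, ?_, ?_⟩
    · filter_upwards [Lp.coeFn_smul c p.1, h1] with x hx hx1
      simp [hx, hx1]
    · filter_upwards [Lp.coeFn_smul c p.2, h2] with x hx hx1
      rw [gradient_const_smul (hη.differentiable x), ← hx1]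
      exact hx

theorem IsTestFunction.toLp_mem_testGraph (hη : IsTestFunction Ω η) :
    ((hη.memLp 2).toLp _, (hη.memLp_gradient 2).toLp _) ∈ testGraph Ω Ω :=
  ⟨η, hη, (hη.memLp 2).coeFn_toLp, (hη.memLp_gradient 2).coeFn_toLp⟩

theorem mem_closure_testGraph {p : L2 Ω × L2Vec Ω}
    (h : ∀ ε : ENNReal, 0 < ε → ∃ η, IsTestFunction Ω' η ∧
      eLpNorm (fun x => η x - p.1 x) 2 (volume.restrict Ω) ≤ ε ∧
      eLpNorm (fun x => ∇ η x - p.2 x) 2 (volume.restrict Ω) ≤ ε) :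
    p ∈ (testGraph Ω' Ω).topologicalClosure := by
  refine EMetric.mem_closure_iff.2 fun ε hε => ?_
  obtain ⟨δ, hδ, hδε⟩ := exists_between hε
  obtain ⟨η, hη, h1, h2⟩ := h δ hδ
  have m1 : MemLp η 2 (volume.restrict Ω) :=
    (hη.continuous.memLp_of_hasCompactSupport hη.hasCompactSupport).restrict Ω
  have m2 : MemLp (fun x => ∇ η x) 2 (volume.restrict Ω) :=
    (hη.continuous_gradient.memLp_of_hasCompactSupport
      (HasCompactSupport.intro hη.hasCompactSupport fun _ hx =>
        gradient_eq_zero_of_notMem_tsupport hx)).restrict Ω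
  refine ⟨(m1.toLp _, m2.toLp _), ⟨η, hη, m1.coeFn_toLp, m2.coeFn_toLp⟩, ?_⟩
  rw [edist_comm]
  refine lt_of_le_of_lt (max_le ?_ ?_) hδε
  · refine le_trans (le_of_eq ?_) h1
    rw [Lp.edist_def]
    refine eLpNorm_congr_ae ?_
    filter_upwards [m1.coeFn_toLp] with x hx
    simp [hx]
  · refine le_trans (le_of_eq ?_) h2
    rw [Lp.edist_def]
    refine eLpNorm_congr_ae ?_
    filter_upwards [m2.coeFn_toLp] with x hx
    simp [hx]

theorem exists_of_mem_testGraph {p : L2 Ω × L2Vec Ω} (hp : p ∈ testGraph Ω Ω) :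
    ∃ (η : Space d → ℝ) (hη : IsTestFunction Ω η),
      p = ((hη.memLp 2).toLp _, (hη.memLp_gradient 2).toLp _) := by
  obtain ⟨η, hη, h1, h2⟩ := hp
  exact ⟨η, hη, Prod.ext (Lp.ext (h1.trans (hη.memLp 2).coeFn_toLp.symm))
    (Lp.ext (h2.trans (hη.memLp_gradient 2).coeFn_toLp.symm))⟩

theorem integral_smul_gradient_of_smooth {f : Space d → ℝ} (hf : ContDiff ℝ 1 f)
    (hη : IsTestFunction Ω η) :
    ∫ x in Ω, f x • ∇ η x = -∫ x in Ω, η x • ∇ f x := by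
  have i1 : Integrable (fun x => f x • ∇ η x) volume :=
    (hf.continuous.smul hη.continuous_gradient).integrable_of_hasCompactSupport
      (HasCompactSupport.smul_left (HasCompactSupport.intro hη.hasCompactSupport fun x hx =>
        gradient_eq_zero_of_notMem_tsupport hx))
  have i2 : Integrable (fun x => η x • ∇ f x) volume :=
    (hη.continuous.smul (continuous_gradient hf)).integrable_of_hasCompactSupport
      hη.hasCompactSupport.smul_right
  rw [hη.setIntegral_eq fun x hx => by rw [gradient_eq_zero_of_notMem_tsupport hx, smul_zero],
    hη.setIntegral_eq fun x hx => by rw [image_eq_zero_of_notMem_tsupport hx, zero_smul]]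
  refine ext_inner_left ℝ fun a => ?_
  rw [inner_neg_right, ← integral_inner i1, ← integral_inner i2]
  simp only [← real_inner_comm a]
  simp only [real_inner_smul_left]
  rw [integral_mul_inner_gradient hf (hη.smooth.of_le (by simp)) hη.hasCompactSupport]
  simp only [mul_comm]

/-- `H¹₀(Ω)`, the closure of `C_c^∞(Ω)` in `H¹(Ω)`, as a space of pairs `(φ, ∇φ)`. -/
noncomputable def H10 (Ω : Set (Space d)) : Submodule ℝ (L2 Ω × L2Vec Ω) :=
  (testGraph Ω Ω).topologicalClosure

theorem isClosed_H10 : IsClosed (H10 Ω : Set (L2 Ω × L2Vec Ω)) :=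
  Submodule.isClosed_topologicalClosure _

theorem testGraph_le_H10 : testGraph Ω Ω ≤ H10 Ω := Submodule.le_topologicalClosure _

theorem H10_le_H1 : H10 Ω ≤ H1 Ω := by
  refine Submodule.topologicalClosure_minimal _ ?_ isClosed_H1
  rintro p ⟨η, hη, h1, h2⟩ κ hκ
  have e1 : (fun x => p.1 x • ∇ κ x) =ᵐ[volume.restrict Ω] fun x => η x • ∇ κ x := by
    filter_upwards [h1] with x hx using by rw [hx]
  have e2 : (fun x => κ x • p.2 x) =ᵐ[volume.restrict Ω] fun x => κ x • ∇ η x := by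
    filter_upwards [h2] with x hx using by rw [hx]
  rw [integral_congr_ae e1, integral_congr_ae e2]
  exact integral_smul_gradient_of_smooth (hη.smooth.of_le (by simp)) hκ

/-- Green's formula for `φ ∈ H¹₀(Ω)` and `σ ∈ H(div, Ω)`. -/
theorem inner_add_inner_eq_zero_of_mem_H10 {p : L2 Ω × L2Vec Ω} (hp : p ∈ H10 Ω) {σ : L2Vec Ω}
    {f : L2 Ω} (hσ : IsWeakDivergence Ω σ f) : inner ℝ p.2 σ + inner ℝ p.1 f = 0 := by
  have hcl : IsClosed {p : L2 Ω × L2Vec Ω | inner ℝ p.2 σ + inner ℝ p.1 f = 0} :=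
    isClosed_eq (by fun_prop) (by fun_prop)
  refine closure_minimal (fun q hq => ?_) hcl hp
  obtain ⟨η, hη, rfl⟩ := exists_of_mem_testGraph hq
  exact isWeakDivergence_iff.1 hσ η hη

/-- Poincaré's inequality for test functions. -/
theorem IsTestFunction.norm_toLp_le (hη : IsTestFunction Ω η) {a : Space d} (ha : ‖a‖ = 1)
    {R : ℝ} (hR : ∀ x ∈ Ω, ‖x‖ ≤ R) (hΩ : MeasurableSet Ω) :
    ‖(hη.memLp 2).toLp η‖ ≤ 2 * R * ‖(hη.memLp_gradient 2).toLp (fun x => ∇ η x)‖ := by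
  set u : L2 Ω := (hη.memLp 2).toLp η with hu
  set G : L2Vec Ω := (hη.memLp_gradient 2).toLp (fun x => ∇ η x) with hG
  -- The function x ↦ a·x has derivative 1 in the direction a, so ∫ η² = -∫ (a·x) ∂_a(η²) = ∫ η (-2
  -- (a·x) ∂_a η). With |a·x| ≤ R on Ω this yields the constant 2R.
  have hlin : ContDiff ℝ (⊤ : ℕ∞) fun x : Space d => -2 * inner ℝ a x :=
    contDiff_const.mul (innerSL ℝ a).contDiff
  have hw : MemLp (fun x => (-2 * inner ℝ a x) * inner ℝ (∇ η x) a) 2 (volume.restrict Ω) := by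
    simp only [inner_gradient_left]
    exact ((hlin.continuous.mul ((hη.smooth.continuous_fderiv (by simp)).clm_apply
      continuous_const)).memLp_of_hasCompactSupport
      ((hη.hasCompactSupport.fderiv_apply (𝕜 := ℝ) a).mul_left)).restrict Ω
  have hwn : ‖hw.toLp _‖ ≤ 2 * R * ‖G‖ := by
    refine Lp.norm_le_mul_norm_of_ae_le_mul ?_
    filter_upwards [hw.coeFn_toLp, (hη.memLp_gradient 2).coeFn_toLp, ae_restrict_mem hΩ]
      with x h1 h2 h3
    rw [h1, h2, norm_mul, norm_mul]
    have i1 : ‖inner ℝ a x‖ ≤ R := (norm_inner_le_norm a x).trans (by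
      rw [ha, one_mul]; exact hR x h3)
    have i2 : ‖inner ℝ (∇ η x) a‖ ≤ ‖∇ η x‖ := (norm_inner_le_norm _ _).trans (by
      rw [ha, mul_one])
    have : ‖(-2 : ℝ)‖ = 2 := by norm_num
    rw [this]
    have hR0 : 0 ≤ R := (norm_nonneg x).trans (hR x h3)
    gcongr
  have hsq : ‖u‖ ^ 2 = inner ℝ u (hw.toLp _) := by
    rw [← real_inner_self_eq_norm_sq, L2.inner_def, L2.inner_def]
    have e1 : (fun x => inner ℝ (u x) (u x)) =ᵐ[volume.restrict Ω] fun x => η x * η x := by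
      filter_upwards [(hη.memLp 2).coeFn_toLp] with x hx
      rw [hx]; simp [sq]
    have e2 : (fun x => inner ℝ (u x) (hw.toLp _ x)) =ᵐ[volume.restrict Ω]
        fun x => -(inner ℝ a x * inner ℝ (∇ (fun y => η y * η y) x) a) := by
      filter_upwards [(hη.memLp 2).coeFn_toLp, hw.coeFn_toLp] with x h1 h2
      rw [h1, h2, gradient_mul (hη.differentiable x) (hη.differentiable x), ← two_smul ℝ,
        real_inner_smul_left, real_inner_smul_left]
      simp
      ring
    have h2 : IsTestFunction Ω fun x => η x * η x := hη.mul_left hη.smooth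
    rw [integral_congr_ae e1, integral_congr_ae e2, integral_neg,
      h2.setIntegral_eq fun x hx => image_eq_zero_of_notMem_tsupport hx,
      h2.setIntegral_eq fun x hx => by simp [gradient_eq_zero_of_notMem_tsupport hx],
      integral_mul_inner_gradient (f := fun x => inner ℝ a x) (innerSL ℝ a).contDiff
        (h2.smooth.of_le (by simp)) h2.hasCompactSupport,
      neg_neg]
    refine integral_congr_ae (Filter.Eventually.of_forall fun x => ?_)
    have : inner ℝ (∇ (fun x : Space d => inner ℝ a x) x) a = 1 := by
      rw [inner_gradient_left]
      have := ((innerSL ℝ a).hasFDerivAt (x := x)).fderiv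
      simp only [coe_innerSL_apply] at this
      rw [this]
      simp [ha]
    simp only [this, one_mul]
  rcases eq_or_ne ‖u‖ 0 with h0 | h0
  · rw [h0]
    exact (norm_nonneg _).trans hwn
  · refine le_of_mul_le_mul_left ?_ ((norm_nonneg u).lt_of_ne' h0)
    calc ‖u‖ * ‖u‖ = inner ℝ u (hw.toLp _) := by rw [← hsq, sq]
      _ ≤ ‖u‖ * ‖hw.toLp _‖ := real_inner_le_norm _ _
      _ ≤ ‖u‖ * (2 * R * ‖G‖) := by gcongr

/-- Poincaré's inequality on `H¹₀(Ω)`. -/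
theorem exists_norm_fst_le_of_mem_H10 (hd : 0 < d) (hΩ : MeasurableSet Ω)
    (hb : Bornology.IsBounded Ω) :
    ∃ C : NNReal, ∀ p ∈ H10 Ω, ‖p.1‖ ≤ C * ‖p.2‖ := by
  obtain ⟨R, hR⟩ := hb.exists_norm_le
  have ha : ‖EuclideanSpace.single (⟨0, hd⟩ : Fin d) (1 : ℝ)‖ = 1 := by simp
  refine ⟨Real.toNNReal (2 * R), fun p hp => ?_⟩
  have hcl : IsClosed {p : L2 Ω × L2Vec Ω | ‖p.1‖ ≤ Real.toNNReal (2 * R) * ‖p.2‖} :=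
    isClosed_le (by fun_prop) (by fun_prop)
  refine closure_minimal (fun q hq => ?_) hcl hp
  obtain ⟨η, hη, rfl⟩ := exists_of_mem_testGraph hq
  exact (hη.norm_toLp_le ha hR hΩ).trans
    (mul_le_mul_of_nonneg_right (Real.le_coe_toNNReal _) (norm_nonneg _))

end TestFunction

/-! ### Shifting a Lipschitz domain into itself; partition of unity -/

section Geometry

variable {d : ℕ} {Ω : Set (Space d)}

/-- In `B`, the set `Ω` consists of the points strictly below the graph of the Lipschitz function
`h`, where `e` is the vertical direction. -/
structure IsSubgraphIn (Ω : Set (Space d)) (B : Set (Space d)) (e : Space d) (K : NNReal)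
    (h : (Submodule.span ℝ {e})ᗮ → ℝ) : Prop where
  norm_eq_one : ‖e‖ = 1
  lipschitzWith : LipschitzWith K h
  mem_iff : ∀ y ∈ B,
    y ∈ Ω ↔ inner ℝ e y < h ((Submodule.span ℝ {e})ᗮ.orthogonalProjectionOnto y)

/-- Moving a point of `closure Ω` by `-t • e`, up to an error `c * t`, leads into `Ω`, if the
starting point or the end point lies in `K`. -/
def ShiftsInto (Ω K : Set (Space d)) (e : Space d) : Prop :=
  ∃ c > 0, ∃ t₀ > 0, ∀ t : ℝ, 0 < t → t < t₀ → ∀ y ∈ closure Ω, ∀ z : Space d, ‖z‖ ≤ c * t →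
    (y ∈ K ∨ y - t • e + z ∈ K) → y - t • e + z ∈ Ω

/-- Away from the boundary no shift is needed: a compact subset of Ω has a positive distance to the
complement, so the direction 0 serves. -/
theorem shiftsInto_zero_of_isCompact (hΩ : IsOpen Ω) {K : Set (Space d)} (hK : IsCompact K)
    (h : K ⊆ Ω) : ShiftsInto Ω K 0 := by
  obtain ⟨δ, hδ, hsub⟩ := hK.exists_cthickening_subset_open hΩ h
  refine ⟨1, one_pos, δ, hδ, fun t _ ht y _ z hz hyz => ?_⟩
  rcases hyz with hy | hy
  · refine hsub (Metric.mem_cthickening_of_dist_le _ y _ _ hy ?_)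
    simp only [smul_zero, sub_zero, dist_self_add_left]
    linarith
  · exact h hy

namespace IsSubgraphIn

variable {B : Set (Space d)} {e : Space d} {K : NNReal} {h : (Submodule.span ℝ {e})ᗮ → ℝ}

theorem continuous_height (hg : IsSubgraphIn Ω B e K h) :
    Continuous fun y => h ((Submodule.span ℝ {e})ᗮ.orthogonalProjectionOnto y) :=
  hg.lipschitzWith.continuous.comp (by fun_prop)

/-- The points of `B` strictly above the graph form an open set that misses Ω. -/
theorem inner_le_of_mem_closure (hg : IsSubgraphIn Ω B e K h) (hB : IsOpen B) {y : Space d}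
    (hyB : y ∈ B) (hy : y ∈ closure Ω) :
    inner ℝ e y ≤ h ((Submodule.span ℝ {e})ᗮ.orthogonalProjectionOnto y) := by
  by_contra! hlt
  have hopen : IsOpen ({y | h ((Submodule.span ℝ {e})ᗮ.orthogonalProjectionOnto y) < inner ℝ e y}
      ∩ B) := (isOpen_lt hg.continuous_height (by fun_prop)).inter hB
  obtain ⟨w, ⟨hw1, hw2⟩, hw3⟩ := mem_closure_iff.1 hy _ hopen ⟨hlt, hyB⟩
  exact lt_asymm hw1 ((hg.mem_iff w hw2).1 hw3)

theorem projection_self (e : Space d) :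
    (Submodule.span ℝ {e})ᗮ.orthogonalProjectionOnto e = 0 :=
  Submodule.orthogonalProjectionOnto_orthogonalComplement_singleton_eq_zero e

theorem shiftsInto {x : Space d} {r : ℝ} (hr : 0 < r)
    (hg : IsSubgraphIn Ω (Metric.ball x r) e K h) {S : Set (Space d)}
    (hS : S ⊆ Metric.ball x (r / 2)) : ShiftsInto Ω S e := by
  -- The shift by -t • e gains height t, while the error z costs at most (1 + K)‖z‖ ≤ t/2 relative
  -- to the graph. The total displacement is at most 3t/2 < r/2 for t < r/4, so if one of the two
  -- points is in the half ball, both are in the ball where Ω is a subgraph.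
  refine ⟨1 / (2 * (1 + K)), by positivity, r / 4, by positivity, ?_⟩
  intro t ht0 ht y hy z hz hyS
  have hK : (0 : ℝ) ≤ K := K.2
  have hct : 1 / (2 * (1 + (K : ℝ))) * t * (1 + K) = t / 2 := by field_simp
  have hz' : ‖z‖ * (1 + K) ≤ t / 2 := by rw [← hct]; gcongr
  have hzt : ‖z‖ ≤ t / 2 := by nlinarith [norm_nonneg z]
  have hdist : dist (y - t • e + z) y < r / 2 := by
    rw [dist_eq_norm]
    calc ‖y - t • e + z - y‖ = ‖z - t • e‖ := by congr 1; abel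
      _ ≤ ‖z‖ + ‖t • e‖ := norm_sub_le _ _
      _ = ‖z‖ + t := by rw [norm_smul, hg.norm_eq_one, Real.norm_of_nonneg ht0.le, mul_one]
      _ < r / 2 := by linarith
  have hyB : y ∈ Metric.ball x r ∧ y - t • e + z ∈ Metric.ball x r := by
    rcases hyS with hyS | hyS
    · have := Metric.mem_ball.1 (hS hyS)
      refine ⟨Metric.mem_ball.2 (by linarith), Metric.mem_ball.2 ?_⟩
      linarith [dist_triangle (y - t • e + z) y x]
    · have := Metric.mem_ball.1 (hS hyS)
      refine ⟨Metric.mem_ball.2 ?_, Metric.mem_ball.2 (by linarith)⟩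
      linarith [dist_triangle y (y - t • e + z) x, dist_comm y (y - t • e + z)]
  rw [hg.mem_iff _ hyB.2]
  have h1 := hg.inner_le_of_mem_closure Metric.isOpen_ball hyB.1 hy
  have h2 : inner ℝ e (y - t • e + z) = inner ℝ e y - t + inner ℝ e z := by
    rw [inner_add_right, inner_sub_right, real_inner_smul_right, real_inner_self_eq_norm_sq,
      hg.norm_eq_one]
    ring
  have h3 : inner ℝ e z ≤ ‖z‖ := by
    simpa [hg.norm_eq_one] using real_inner_le_norm e z
  have h4 := hg.lipschitzWith.dist_le_mul
    ((Submodule.span ℝ {e})ᗮ.orthogonalProjectionOnto y)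
    ((Submodule.span ℝ {e})ᗮ.orthogonalProjectionOnto (y - t • e + z))
  have h5 : dist ((Submodule.span ℝ {e})ᗮ.orthogonalProjectionOnto y)
    ((Submodule.span ℝ {e})ᗮ.orthogonalProjectionOnto (y - t • e + z)) ≤ ‖z‖ := by
    rw [map_add, map_sub, map_smul, projection_self, smul_zero, sub_zero, dist_self_add_right]
    exact Submodule.norm_orthogonalProjectionOnto_apply_le _ z
  rw [Real.dist_eq] at h4
  have h6 := (abs_le.1 h4).2
  have h7 : (K : ℝ) * dist ((Submodule.span ℝ {e})ᗮ.orthogonalProjectionOnto y)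
    ((Submodule.span ℝ {e})ᗮ.orthogonalProjectionOnto (y - t • e + z)) ≤ K * ‖z‖ := by gcongr
  rw [h2]
  nlinarith

end IsSubgraphIn

/-- A bounded Lipschitz domain has a smooth partition of unity on its closure each of whose
functions is supported in `Ω`, or near a boundary point where `Ω` is a Lipschitz subgraph. -/
theorem IsBoundedLipschitzDomain.exists_partition (hΩ : IsBoundedLipschitzDomain Ω) :
    ∃ (ι : Type) (_ : Fintype ι) (θ : ι → Space d → ℝ),
      (∀ i, IsTestFunction univ (θ i)) ∧ (∀ i x, 0 ≤ θ i x) ∧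
      (∀ x ∈ closure Ω, ∑ i, θ i x = 1) ∧
      ∀ i, tsupport (θ i) ⊆ Ω ∨ ∃ (x : Space d) (r : ℝ) (e : Space d) (K : NNReal)
        (h : (Submodule.span ℝ {e})ᗮ → ℝ), 0 < r ∧ tsupport (θ i) ⊆ Metric.ball x (r / 2) ∧
          IsSubgraphIn Ω (Metric.ball x r) e K h := by
  have hU : ∀ x ∈ closure Ω, ∃ U : Set (Space d), IsOpen U ∧ x ∈ U ∧ Bornology.IsBounded U ∧
      (U ⊆ Ω ∨ ∃ (x : Space d) (r : ℝ) (e : Space d) (K : NNReal)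
        (h : (Submodule.span ℝ {e})ᗮ → ℝ), 0 < r ∧ U ⊆ Metric.ball x (r / 2) ∧
          IsSubgraphIn Ω (Metric.ball x r) e K h) := by
    intro x hx
    by_cases hxΩ : x ∈ Ω
    · exact ⟨Ω, hΩ.isOpen, hxΩ, hΩ.isBounded, Or.inl subset_rfl⟩
    · have hxf : x ∈ frontier Ω := ⟨hx, by rwa [hΩ.isOpen.interior_eq]⟩
      obtain ⟨e, he, K, h, hLip, r, hr, hmem⟩ := hΩ.locally_subgraph x hxf
      -- The half ball leaves room for the shifts.
      exact ⟨Metric.ball x (r / 2), Metric.isOpen_ball, Metric.mem_ball_self (by positivity),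
        Metric.isBounded_ball, Or.inr ⟨x, r, e, K, h, hr, subset_rfl, he, hLip, hmem⟩⟩
  choose! U hUo hxU hUb hU using hU
  obtain ⟨t, hts, ht⟩ := hΩ.isBounded.isCompact_closure.elim_nhds_subcover U
    fun x hx => (hUo x hx).mem_nhds (hxU x hx)
  obtain ⟨f, hf⟩ := SmoothPartitionOfUnity.exists_isSubordinate (modelWithCornersSelf ℝ (Space d))
    isClosed_closure (fun i : t => U i) (fun i => hUo i (hts i i.2))
    (fun x hx => by simpa using ht hx)
  refine ⟨t, inferInstance, fun i => f i, fun i => ⟨(f i).contMDiff.contDiff, ?_, subset_univ _⟩,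
    f.nonneg, fun x hx => ?_, fun i => ?_⟩
  · exact Metric.isCompact_of_isClosed_isBounded (isClosed_tsupport _)
      ((hUb i (hts i i.2)).subset (hf i))
  · rw [← finsum_eq_sum_of_fintype]
    exact f.sum_eq_one hx
  · rcases hU i (hts i i.2) with h | ⟨x, r, e, K, h, hr, hsub, hg⟩
    · exact Or.inl ((hf i).trans h)
    · exact Or.inr ⟨x, r, e, K, h, hr, (hf i).trans hsub, hg⟩

end Geometry

/-! ### Density of smooth functions in H¹(Ω) and of test functions among zero extensions -/

section Density

open scoped Pointwise

variable {d : ℕ} {Ω Ω' : Set (Space d)} {θ ρ : Space d → ℝ}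

theorem integral_smul_translate_eq {E : Type*} [NormedAddCommGroup E] [NormedSpace ℝ E]
    (ρ : Space d → ℝ) (f : Space d → E) (x : Space d) :
    ∫ t, ρ t • f (x - t) = ∫ w, ρ (x - w) • f w := by
  rw [← integral_sub_left_eq_self (fun w => ρ (x - w) • f w) volume x]
  simp

theorem smul_translate_eq_convolution (ρ f : Space d → ℝ) :
    (fun x => ∫ t, ρ t • f (x - t)) =
      convolution f ρ (ContinuousLinearMap.lsmul ℝ ℝ) volume := by
  funext x
  rw [integral_smul_translate_eq]
  exact integral_congr_ae (Filter.Eventually.of_forall fun w => mul_comm _ _)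

theorem contDiff_convolution_of_isTestFunction {f : Space d → ℝ} (hf : LocallyIntegrable f volume)
    (hρ : IsTestFunction Ω' ρ) :
    ContDiff ℝ (⊤ : ℕ∞) fun x => ∫ t, ρ t • f (x - t) := by
  rw [smul_translate_eq_convolution]
  exact hρ.hasCompactSupport.contDiff_convolution_right _ hf hρ.smooth

theorem gradient_convolution {f : Space d → ℝ} (hf : LocallyIntegrable f volume)
    (hρ : IsTestFunction Ω' ρ) (y : Space d) :
    ∇ (fun x => ∫ t, ρ t • f (x - t)) y = ∫ w, f w • ∇ ρ (y - w) := by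
  rw [smul_translate_eq_convolution]
  have h := hρ.hasCompactSupport.hasFDerivAt_convolution_right (ContinuousLinearMap.lsmul ℝ ℝ)
    hf (hρ.smooth.of_le (by simp)) y
  rw [gradient, h.fderiv, convolution_def]
  exact ((InnerProductSpace.toDual ℝ (Space d)).symm.toContinuousLinearEquiv.integral_comp_comm
    (μ := volume) fun w => f w • fderiv ℝ ρ (y - w)).symm.trans (by simp [gradient])

/-- `θ φ`, extended by zero outside `Ω`. -/
noncomputable def cutFn (Ω : Set (Space d)) (θ : Space d → ℝ) (φ : L2 Ω) : Space d → ℝ :=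
  Ω.indicator fun x => θ x * φ x

/-- `θ G + φ ∇θ`, extended by zero outside `Ω`. -/
noncomputable def cutGrad (Ω : Set (Space d)) (θ : Space d → ℝ) (φ : L2 Ω) (G : L2Vec Ω) :
    Space d → Space d :=
  Ω.indicator fun x => θ x • G x + φ x • ∇ θ x

theorem IsTestFunction.memLp_mul (hθ : IsTestFunction Ω' θ) (φ : L2 Ω) :
    MemLp (fun x => θ x * φ x) 2 (volume.restrict Ω) :=
  have h : MemLp θ ⊤ (volume.restrict Ω) :=
    (hθ.continuous.memLp_of_hasCompactSupport hθ.hasCompactSupport).restrict Ω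
  (Lp.memLp φ).mul h

theorem IsTestFunction.memLp_smul_add (hθ : IsTestFunction Ω' θ) (φ : L2 Ω) (G : L2Vec Ω) :
    MemLp (fun x => θ x • G x + φ x • ∇ θ x) 2 (volume.restrict Ω) := by
  have h : MemLp θ ⊤ (volume.restrict Ω) :=
    (hθ.continuous.memLp_of_hasCompactSupport hθ.hasCompactSupport).restrict Ω
  have h' : MemLp (fun x => ∇ θ x) ⊤ (volume.restrict Ω) :=
    (hθ.continuous_gradient.memLp_of_hasCompactSupport
      (HasCompactSupport.intro hθ.hasCompactSupport fun _ hx =>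
        gradient_eq_zero_of_notMem_tsupport hx)).restrict Ω
  exact ((Lp.memLp G).smul h).add (h'.smul (Lp.memLp φ))

theorem IsTestFunction.memLp_cutFn (hθ : IsTestFunction Ω' θ) (hΩ : MeasurableSet Ω)
    (φ : L2 Ω) : MemLp (cutFn Ω θ φ) 2 volume :=
  (memLp_indicator_iff_restrict hΩ).2 (hθ.memLp_mul φ)

theorem IsTestFunction.memLp_cutGrad (hθ : IsTestFunction Ω' θ) (hΩ : MeasurableSet Ω)
    (φ : L2 Ω) (G : L2Vec Ω) : MemLp (cutGrad Ω θ φ G) 2 volume :=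
  (memLp_indicator_iff_restrict hΩ).2 (hθ.memLp_smul_add φ G)

theorem contDiff_reflect_translate (hρ : IsTestFunction Ω' ρ) (y : Space d) :
    ContDiff ℝ (⊤ : ℕ∞) fun w => ρ (y - w) :=
  hρ.smooth.comp (contDiff_const.sub contDiff_id)

theorem gradient_reflect_translate (hρ : IsTestFunction Ω' ρ) (y w : Space d) :
    ∇ (fun w => ρ (y - w)) w = -∇ ρ (y - w) := by
  have h : HasFDerivAt (fun w => ρ (y - w)) (-(fderiv ℝ ρ (y - w))) w := by
    exact HasFDerivAt.congr_fderiv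
      ((hρ.differentiable (y - w)).hasFDerivAt.comp w ((hasFDerivAt_id w).const_sub y))
      (by ext; simp)
  rw [gradient, h.fderiv, map_neg, gradient]

/-- Where the weak-gradient identity may be tested against `w ↦ ρ (y - w) * θ w`, the gradient at
`y` of the mollification of `θ φ` is the mollification of `θ ∇φ + φ ∇θ`. -/
theorem gradient_convolution_cutFn (hΩ : MeasurableSet Ω) (hθ : IsTestFunction univ θ)
    (hρ : IsTestFunction univ ρ) (φ : L2 Ω) (G : L2Vec Ω) (y : Space d)
    (h : ∫ x in Ω, φ x • ∇ (fun w => ρ (y - w) * θ w) x =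
      -∫ x in Ω, (ρ (y - x) * θ x) • G x) :
    ∇ (fun x => ∫ t, ρ t • cutFn Ω θ φ (x - t)) y = ∫ t, ρ t • cutGrad Ω θ φ G (y - t) := by
  rw [gradient_convolution ((hθ.memLp_cutFn hΩ φ).locallyIntegrable (by norm_num)) hρ,
    integral_smul_translate_eq ρ (cutGrad Ω θ φ G)]
  have e1 : (fun w => cutFn Ω θ φ w • ∇ ρ (y - w)) =
      Ω.indicator fun w => φ w • (θ w • ∇ ρ (y - w)) := by
    funext w
    by_cases hw : w ∈ Ω <;> simp [cutFn, hw, smul_smul, mul_comm]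
  have e2 : (fun w => ρ (y - w) • cutGrad Ω θ φ G w) =
      Ω.indicator fun w => (ρ (y - w) * θ w) • G w + φ w • (ρ (y - w) • ∇ θ w) := by
    funext w
    by_cases hw : w ∈ Ω <;> simp [cutGrad, hw, smul_smul, mul_comm]
  rw [e1, e2, integral_indicator hΩ, integral_indicator hΩ]
  have hκ : IsTestFunction univ fun w => ρ (y - w) * θ w :=
    hθ.mul_left (contDiff_reflect_translate hρ y)
  have hc : Continuous fun w => ρ (y - w) := (contDiff_reflect_translate hρ y).continuous
  have hint : ∀ F : Space d → Space d, Continuous F → HasCompactSupport F →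
      Integrable (fun w => φ w • F w) (volume.restrict Ω) := fun F hF hF' =>
    have hm : MemLp F 2 (volume.restrict Ω) := (hF.memLp_of_hasCompactSupport hF').restrict Ω
    memLp_one_iff_integrable.1 (hm.smul (Lp.memLp φ))
  have i1 := hint (fun w => θ w • ∇ ρ (y - w))
    (hθ.continuous.smul (hρ.continuous_gradient.comp (by fun_prop)))
    hθ.hasCompactSupport.smul_right
  have i2 := hint (fun w => ρ (y - w) • ∇ θ w) (hc.smul hθ.continuous_gradient)
    (HasCompactSupport.intro hθ.hasCompactSupport fun w hw => by
      rw [gradient_eq_zero_of_notMem_tsupport hw, smul_zero])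
  rw [integral_add (hκ.integrable_smul' G) i2]
  -- The reflection w ↦ y - w produces the minus sign, so the weak identity tested against ρ(y - ·)θ
  -- exchanges the integral of φ θ ∇ρ(y - ·) for those of ρ(y - ·) θ G and ρ(y - ·) φ ∇θ.
  have e3 : (fun x => φ x • ∇ (fun w => ρ (y - w) * θ w) x) = fun x =>
      φ x • (ρ (y - x) • ∇ θ x) - φ x • (θ x • ∇ ρ (y - x)) := by
    funext x
    rw [gradient_mul ((contDiff_reflect_translate hρ y).differentiable (by simp) x)
      (hθ.differentiable x), gradient_reflect_translate hρ]
    simp only [smul_add, smul_neg, sub_eq_add_neg]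
  rw [e3, integral_sub i2 i1] at h
  rw [← neg_eq_iff_eq_neg.2 h]
  abel

theorem support_convolution_cutFn_subset (ρ θ : Space d → ℝ) (φ : L2 Ω) {y : Space d}
    (hy : ∫ t, ρ t • cutFn Ω θ φ (y - t) ≠ 0) :
    ∃ t ∈ tsupport ρ, y - t ∈ closure Ω ∩ tsupport θ := by
  by_contra! hcon
  refine hy (integral_eq_zero_of_ae (Filter.Eventually.of_forall fun t => ?_))
  by_cases ht : t ∈ tsupport ρ
  · have h := hcon t ht
    have : cutFn Ω θ φ (y - t) = 0 := by
      by_cases hΩ : y - t ∈ Ω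
      · have hθ : y - t ∉ tsupport θ := fun h' => h ⟨subset_closure hΩ, h'⟩
        simp [cutFn, image_eq_zero_of_notMem_tsupport hθ]
      · simp [cutFn, hΩ]
    simp [this]
  · simp [image_eq_zero_of_notMem_tsupport ht]

/-- Mollification of `θ φ` by densities concentrated at the origin. -/
theorem mul_mem_closure_testGraph (hΩ : MeasurableSet Ω) (hθ : IsTestFunction univ θ)
    (φ : L2 Ω) (G : L2Vec Ω)
    (h : ∀ δ > 0, ∃ ρ : Space d → ℝ, IsTestFunction (Metric.ball 0 δ) ρ ∧ (∀ x, 0 ≤ ρ x) ∧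
      ∫ x, ρ x = 1 ∧
      (∀ y ∈ Ω, ∫ x in Ω, φ x • ∇ (fun w => ρ (y - w) * θ w) x =
        -∫ x in Ω, (ρ (y - x) * θ x) • G x) ∧
      ∀ t ∈ tsupport ρ, ∀ w ∈ closure Ω ∩ tsupport θ, w + t ∈ Ω') :
    ((hθ.memLp_mul φ).toLp _, (hθ.memLp_smul_add φ G).toLp _) ∈
      (testGraph Ω' Ω).topologicalClosure := by
  refine mem_closure_testGraph fun ε hε => ?_
  obtain ⟨δ₁, hδ₁, h1⟩ := exists_eLpNorm_convolution_sub_le (hθ.memLp_cutFn hΩ φ) hε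
  obtain ⟨δ₂, hδ₂, h2⟩ := exists_eLpNorm_convolution_sub_le (hθ.memLp_cutGrad hΩ φ G) hε
  -- A single density approximates the function and the gradient at once.
  obtain ⟨ρ, hρ, h0, hint, hid, hsupp⟩ := h (min δ₁ δ₂) (lt_min hδ₁ hδ₂)
  have hρu := hρ.mono (subset_univ _)
  have hsub : Function.support ρ ⊆ Metric.ball 0 (min δ₁ δ₂) :=
    (subset_tsupport ρ).trans hρ.tsupport_subset
  have hK : IsCompact ((closure Ω ∩ tsupport θ) + tsupport ρ) :=
    (hθ.hasCompactSupport.isCompact.inter_left isClosed_closure).add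
      hρ.hasCompactSupport.isCompact
  have hts : tsupport (fun x => ∫ t, ρ t • cutFn Ω θ φ (x - t)) ⊆
      (closure Ω ∩ tsupport θ) + tsupport ρ := by
    refine closure_minimal (fun y hy => ?_) hK.isClosed
    obtain ⟨t, ht, hyt⟩ := support_convolution_cutFn_subset ρ θ φ hy
    exact ⟨y - t, hyt, t, ht, by simp⟩
  refine ⟨fun x => ∫ t, ρ t • cutFn Ω θ φ (x - t), ⟨contDiff_convolution_of_isTestFunction
    ((hθ.memLp_cutFn hΩ φ).locallyIntegrable (by norm_num)) hρ,
    hK.of_isClosed_subset (isClosed_tsupport _) hts, fun y hy => ?_⟩, ?_, ?_⟩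
  · obtain ⟨w, hw, t, ht, rfl⟩ := hts hy
    exact hsupp t ht w hw
  · refine le_trans (le_trans (le_of_eq ?_) (eLpNorm_mono_measure _ (Measure.restrict_le_self (s := Ω))))
      (h1 ρ hρ.continuous h0 (hsub.trans (Metric.ball_subset_ball (min_le_left _ _))) hint)
    refine eLpNorm_congr_ae ?_
    filter_upwards [(hθ.memLp_mul φ).coeFn_toLp, ae_restrict_mem hΩ] with x hx hxΩ
    rw [hx]
    simp [cutFn, hxΩ]
  · refine le_trans (le_trans (le_of_eq ?_) (eLpNorm_mono_measure _ (Measure.restrict_le_self (s := Ω))))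
      (h2 ρ hρ.continuous h0 (hsub.trans (Metric.ball_subset_ball (min_le_right _ _))) hint)
    refine eLpNorm_congr_ae ?_
    filter_upwards [(hθ.memLp_smul_add φ G).coeFn_toLp, ae_restrict_mem hΩ] with x hx hxΩ
    rw [hx, gradient_convolution_cutFn hΩ hθ hρu φ G x (hid x hxΩ)]
    simp [cutGrad, hxΩ]

/-- There is a smooth probability density supported in `closedBall a R`. -/
theorem exists_smooth_density (a : Space d) {R : ℝ} (hR : 0 < R) :
    ∃ ρ : Space d → ℝ, ContDiff ℝ (⊤ : ℕ∞) ρ ∧ (∀ x, 0 ≤ ρ x) ∧ ∫ x, ρ x = 1 ∧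
      tsupport ρ = Metric.closedBall a R := by
  let b : ContDiffBump a := ⟨R / 2, R, by positivity, by linarith⟩
  exact ⟨b.normed volume, b.contDiff_normed, b.nonneg_normed, b.integral_normed,
    b.tsupport_normed_eq⟩

/-- The centre t • e and radius c * t match the cone of displacements in `ShiftsInto`. Points of the
support have norm at most t(‖e‖ + c), which dictates the bound on t. -/
theorem exists_smooth_density_in_ball (e : Space d) {c t₀ δ : ℝ} (hc : 0 < c) (ht₀ : 0 < t₀)
    (hδ : 0 < δ) :
    ∃ t : ℝ, 0 < t ∧ t < t₀ ∧ ∃ ρ : Space d → ℝ, IsTestFunction (Metric.ball 0 δ) ρ ∧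
      (∀ x, 0 ≤ ρ x) ∧ ∫ x, ρ x = 1 ∧ tsupport ρ = Metric.closedBall (t • e) (c * t) := by
  obtain ⟨t, ht, htlt⟩ := exists_between (lt_min ht₀ (show 0 < δ / (‖e‖ + c) by positivity))
  obtain ⟨ρ, h1, h2, h3, h4⟩ := exists_smooth_density (t • e) (mul_pos hc ht)
  refine ⟨t, ht, htlt.trans_le (min_le_left _ _), ρ, ⟨h1, ?_, ?_⟩, h2, h3, h4⟩
  · rw [HasCompactSupport, h4]
    exact isCompact_closedBall _ _
  · rw [h4]
    intro x hx
    have h5 : t * (‖e‖ + c) < δ := (lt_div_iff₀ (by positivity)).1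
      (htlt.trans_le (min_le_right _ _))
    have h6 := mem_closedBall_iff_norm.1 hx
    rw [mem_ball_zero_iff]
    calc ‖x‖ = ‖(x - t • e) + t • e‖ := by simp
      _ ≤ ‖x - t • e‖ + ‖t • e‖ := norm_add_le _ _
      _ ≤ c * t + t * ‖e‖ := by
          rw [norm_smul, Real.norm_of_nonneg ht.le]; gcongr
      _ < δ := by linarith

/-- Density of smooth functions in `H¹(Ω)`, locally. -/
theorem mul_mem_closure_testGraph_univ (hΩ : IsOpen Ω) (hθ : IsTestFunction univ θ)
    {e : Space d} (hs : ShiftsInto Ω (tsupport θ) e) {p : L2 Ω × L2Vec Ω} (hp : p ∈ H1 Ω) :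
    ((hθ.memLp_mul p.1).toLp _, (hθ.memLp_smul_add p.1 p.2).toLp _) ∈
      (testGraph univ Ω).topologicalClosure := by
  obtain ⟨c, hc, t₀, ht₀, hs⟩ := hs
  refine mul_mem_closure_testGraph hΩ.measurableSet hθ p.1 p.2 fun δ hδ => ?_
  -- Centred at t • e, the mollification at y ∈ Ω samples points near y - t • e. Those in `tsupport
  -- θ` lie in Ω by the shift property in its end-point form, so w ↦ ρ(y - w)θ(w) is a test function
  -- on Ω.
  obtain ⟨t, ht, htt₀, ρ, hρ, h0, h1, hsupp⟩ := exists_smooth_density_in_ball e hc ht₀ hδ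
  refine ⟨ρ, hρ, h0, h1, fun y hy => hp _ ?_, fun _ _ _ _ => mem_univ _⟩
  have h := hθ.mul_left (contDiff_reflect_translate (hρ.mono (subset_univ _)) y)
  refine ⟨h.smooth, h.hasCompactSupport, ?_⟩
  have hcl : IsClosed ({w | y - w ∈ tsupport ρ} ∩ tsupport θ) :=
    ((isClosed_tsupport ρ).preimage (by fun_prop)).inter (isClosed_tsupport θ)
  refine (closure_minimal (fun w hw => ?_) hcl).trans fun w hw => ?_
  · exact ⟨subset_tsupport ρ (left_ne_zero_of_mul hw), subset_tsupport θ (right_ne_zero_of_mul hw)⟩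
  · have h2 := hw.1
    simp only [mem_ofPred_eq, hsupp, mem_closedBall_iff_norm] at h2
    have h3 : y - t • e + -(y - w - t • e) = w := by abel
    have h4 := hs t ht htt₀ y (subset_closure hy) (-(y - w - t • e)) (by rwa [norm_neg])
      (Or.inr (by rw [h3]; exact hw.2))
    rwa [h3] at h4

/-- If the extension by zero of `φ` has a weak gradient on `ℝ^d`, then `φ` is locally in the
closure of the test functions. -/
theorem mul_mem_H10 (hΩ : MeasurableSet Ω) (hθ : IsTestFunction univ θ)
    {e : Space d} (hs : ShiftsInto Ω (tsupport θ) e) {p : L2 Ω × L2Vec Ω}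
    (hp : ∀ κ, IsTestFunction univ κ → ∫ x in Ω, p.1 x • ∇ κ x = -∫ x in Ω, κ x • p.2 x) :
    ((hθ.memLp_mul p.1).toLp _, (hθ.memLp_smul_add p.1 p.2).toLp _) ∈ H10 Ω := by
  obtain ⟨c, hc, t₀, ht₀, hs⟩ := hs
  refine mul_mem_closure_testGraph hΩ hθ p.1 p.2 fun δ hδ => ?_
  -- The opposite direction: centred at -t • e, the mollification moves the support of the cut-off
  -- function by about -t • e, hence into Ω, by the starting-point form of the shift property. Its
  -- test functions may cross Γ, which `hp` permits.
  obtain ⟨t, ht, htt₀, ρ, hρ, h0, h1, hsupp⟩ := exists_smooth_density_in_ball (-e) hc ht₀ hδ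
  refine ⟨ρ, hρ, h0, h1, fun y _ => hp _ (hθ.mul_left
    (contDiff_reflect_translate (hρ.mono (subset_univ _)) y)), fun s hs' w hw => ?_⟩
  rw [hsupp, mem_closedBall_iff_norm] at hs'
  have h3 : w - t • e + (s - t • -e) = w + s := by rw [smul_neg]; abel
  rw [← h3]
  exact hs t ht htt₀ w hw.1 _ hs' (Or.inl hw.2)

theorem shiftsInto_of_partition (hΩ : IsOpen Ω) (hθ : IsTestFunction univ θ)
    (h : tsupport θ ⊆ Ω ∨ ∃ (x : Space d) (r : ℝ) (e : Space d) (K : NNReal)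
      (h : (Submodule.span ℝ {e})ᗮ → ℝ), 0 < r ∧ tsupport θ ⊆ Metric.ball x (r / 2) ∧
        IsSubgraphIn Ω (Metric.ball x r) e K h) :
    ∃ e, ShiftsInto Ω (tsupport θ) e := by
  rcases h with h | ⟨x, r, e, K, h, hr, hsub, hg⟩
  · exact ⟨0, shiftsInto_zero_of_isCompact hΩ hθ.hasCompactSupport h⟩
  · exact ⟨e, hg.shiftsInto hr hsub⟩

/-- A pair is the sum of its products with the functions of a partition of unity. -/
theorem sum_mul_toLp (hΩ : IsOpen Ω) {ι : Type*} [Fintype ι] {θ : ι → Space d → ℝ}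
    (hθ : ∀ i, IsTestFunction univ (θ i)) (hsum : ∀ x ∈ closure Ω, ∑ i, θ i x = 1)
    (p : L2 Ω × L2Vec Ω) :
    ∑ i, (((hθ i).memLp_mul p.1).toLp _, ((hθ i).memLp_smul_add p.1 p.2).toLp _) = p := by
  -- The sum of the θ i is constant on the open set Ω, so the product-rule terms φ ∇(θ i) cancel.
  have hgrad : ∀ x ∈ Ω, ∑ i, ∇ (θ i) x = 0 := by
    intro x hx
    have h1 : (fun y => ∑ i, θ i y) =ᶠ[𝓝 x] fun _ => 1 := by
      filter_upwards [hΩ.mem_nhds hx] with y hy using hsum y (subset_closure hy)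
    have h2 := h1.fderiv_eq (𝕜 := ℝ)
    rw [fderiv_fun_sum fun i _ => (hθ i).differentiable x, fderiv_fun_const] at h2
    simp only [gradient]
    rw [← map_sum, h2]
    simp
  refine Prod.ext ?_ ?_
  · rw [Prod.fst_sum]
    refine Lp.ext ?_
    have h2 : ∀ᵐ x ∂volume.restrict Ω, ∀ i, ((hθ i).memLp_mul p.1).toLp _ x = θ i x * p.1 x :=
      ae_all_iff.2 fun i => ((hθ i).memLp_mul p.1).coeFn_toLp
    filter_upwards [Lp.coeFn_finsetSum Finset.univ fun i => ((hθ i).memLp_mul p.1).toLp _, h2,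
      ae_restrict_mem hΩ.measurableSet] with x hx1 hx2 hx3
    rw [hx1]
    simp only [Finset.sum_apply, hx2, ← Finset.sum_mul, hsum x (subset_closure hx3), one_mul]
  · rw [Prod.snd_sum]
    refine Lp.ext ?_
    have h2 : ∀ᵐ x ∂volume.restrict Ω, ∀ i, ((hθ i).memLp_smul_add p.1 p.2).toLp _ x =
        θ i x • p.2 x + p.1 x • ∇ (θ i) x :=
      ae_all_iff.2 fun i => ((hθ i).memLp_smul_add p.1 p.2).coeFn_toLp
    filter_upwards [Lp.coeFn_finsetSum Finset.univ
      fun i => ((hθ i).memLp_smul_add p.1 p.2).toLp _, h2,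
      ae_restrict_mem hΩ.measurableSet] with x hx1 hx2 hx3
    rw [hx1]
    simp only [Finset.sum_apply, hx2, Finset.sum_add_distrib, ← Finset.sum_smul,
      ← Finset.smul_sum, hsum x (subset_closure hx3), hgrad x hx3, one_smul, smul_zero, add_zero]

/-- Restrictions of smooth functions are dense in `H¹(Ω)`. -/
theorem H1_le_closure_testGraph_univ (hΩ : IsBoundedLipschitzDomain Ω) :
    H1 Ω ≤ (testGraph univ Ω).topologicalClosure := by
  intro p hp
  obtain ⟨ι, _, θ, hθ, -, hsum, hcase⟩ := hΩ.exists_partition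
  rw [← sum_mul_toLp hΩ.isOpen hθ hsum p]
  refine Submodule.sum_mem _ fun i _ => ?_
  obtain ⟨e, he⟩ := shiftsInto_of_partition hΩ.isOpen (hθ i) (hcase i)
  exact mul_mem_closure_testGraph_univ hΩ.isOpen (hθ i) he hp

/-- If the extension by zero of `φ` has a weak gradient on `ℝ^d`, then `φ ∈ H¹₀(Ω)`. -/
theorem mem_H10_of_forall_integral (hΩ : IsBoundedLipschitzDomain Ω) {p : L2 Ω × L2Vec Ω}
    (hp : ∀ κ, IsTestFunction univ κ → ∫ x in Ω, p.1 x • ∇ κ x = -∫ x in Ω, κ x • p.2 x) :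
    p ∈ H10 Ω := by
  obtain ⟨ι, _, θ, hθ, -, hsum, hcase⟩ := hΩ.exists_partition
  rw [← sum_mul_toLp hΩ.isOpen hθ hsum p]
  refine Submodule.sum_mem _ fun i _ => ?_
  obtain ⟨e, he⟩ := shiftsInto_of_partition hΩ.isOpen (hθ i) (hcase i)
  exact mul_mem_H10 hΩ.isOpen.measurableSet (hθ i) he hp

end Density

/-! ### Graph coordinates, surface measure on a graph, thin strips -/

section GraphChart

variable {d : ℕ} {e : Space d}

/-- The measurable equivalence `(z, s) ↦ z + s • e` between `e^⊥ × ℝ` and `ℝ^d`. -/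
noncomputable def orthChart (e : Space d) (he : ‖e‖ = 1) :
    (Submodule.span ℝ {e})ᗮ × ℝ ≃ᵐ Space d :=
  MeasurableEquiv.prodComm.trans <|
    (((LinearIsometryEquiv.toSpanUnitSingleton (𝕜 := ℝ) e he).toHomeomorph.toMeasurableEquiv).prodCongr
      (MeasurableEquiv.refl _)).trans
      ((Submodule.span ℝ {e}).measurableEquivProd (0 : Space d)).symm

theorem orthChart_apply (he : ‖e‖ = 1) (p : (Submodule.span ℝ {e})ᗮ × ℝ) :
    orthChart e he p = (p.1 : Space d) + p.2 • e := by
  simp [orthChart, MeasurableEquiv.prodCongr, MeasurableEquiv.prodComm, add_comm]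

theorem measurePreserving_orthChart (he : ‖e‖ = 1) :
    MeasurePreserving (orthChart e he) volume volume := by
  have h1 := ((Submodule.span ℝ {e}).measurePreserving_measurableEquivProd (0 : Space d)).symm
  rw [InnerProductSpace.euclideanHausdorffMeasure_eq_volume] at h1
  have h2 : MeasurePreserving
      (((LinearIsometryEquiv.toSpanUnitSingleton (𝕜 := ℝ) e he).toHomeomorph.toMeasurableEquiv).prodCongr
        (MeasurableEquiv.refl (Submodule.span ℝ {e})ᗮ)) volume volume :=
    MeasurePreserving.prod
      (LinearIsometryEquiv.toSpanUnitSingleton (𝕜 := ℝ) e he).measurePreserving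
      (MeasurePreserving.id volume)
  have h3 : MeasurePreserving (MeasurableEquiv.prodComm :
      (Submodule.span ℝ {e})ᗮ × ℝ ≃ᵐ ℝ × (Submodule.span ℝ {e})ᗮ) volume volume :=
    Measure.measurePreserving_swap
  exact h3.trans (h2.trans h1)

theorem inner_orthChart (he : ‖e‖ = 1) (p : (Submodule.span ℝ {e})ᗮ × ℝ) :
    inner ℝ e (orthChart e he p) = p.2 := by
  have h : inner ℝ e (p.1 : Space d) = 0 :=
    Submodule.mem_orthogonal_singleton_iff_inner_right.1 p.1.2
  rw [orthChart_apply, inner_add_right, h, real_inner_smul_right, real_inner_self_eq_norm_sq, he]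
  simp

theorem projection_orthChart (he : ‖e‖ = 1) (p : (Submodule.span ℝ {e})ᗮ × ℝ) :
    (Submodule.span ℝ {e})ᗮ.orthogonalProjectionOnto (orthChart e he p) = p.1 := by
  rw [orthChart_apply, map_add, map_smul, IsSubgraphIn.projection_self, smul_zero, add_zero,
    Submodule.orthogonalProjectionOnto_mem_subspace_eq_self]

theorem lintegral_eq_lintegral_orthChart (he : ‖e‖ = 1) {F : Space d → ENNReal}
    (hF : Measurable F) :
    ∫⁻ y, F y = ∫⁻ z : (Submodule.span ℝ {e})ᗮ, ∫⁻ s : ℝ, F (orthChart e he (z, s)) := by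
  rw [← (measurePreserving_orthChart he).lintegral_comp hF, Measure.volume_eq_prod,
    lintegral_prod (fun p => F (orthChart e he p))
      (hF.comp (orthChart e he).measurable).aemeasurable]

theorem integral_eq_integral_orthChart (he : ‖e‖ = 1) {F : Space d → ℝ} (hF : Integrable F) :
    ∫ y, F y = ∫ z : (Submodule.span ℝ {e})ᗮ, ∫ s : ℝ, F (orthChart e he (z, s)) := by
  rw [← (measurePreserving_orthChart he).integral_comp' F, Measure.volume_eq_prod,
    integral_prod]
  exact (measurePreserving_orthChart he).integrable_comp_of_integrable hF

/-- The graph of `h` over the hyperplane orthogonal to `e`, as a map. -/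
noncomputable def graphMap (e : Space d) (h : (Submodule.span ℝ {e})ᗮ → ℝ)
    (z : (Submodule.span ℝ {e})ᗮ) :
    Space d := (z : Space d) + h z • e

/-- The open subgraph of `h`. -/
def subgraph (e : Space d) (h : (Submodule.span ℝ {e})ᗮ → ℝ) : Set (Space d) :=
  {y | inner ℝ e y < h ((Submodule.span ℝ {e})ᗮ.orthogonalProjectionOnto y)}

variable {K : NNReal} {h : (Submodule.span ℝ {e})ᗮ → ℝ}

theorem orthChart_height (he : ‖e‖ = 1) (z : (Submodule.span ℝ {e})ᗮ) :
    orthChart e he (z, h z) = graphMap e h z := orthChart_apply he _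

theorem orthChart_mem_subgraph (he : ‖e‖ = 1) (z : (Submodule.span ℝ {e})ᗮ) (s : ℝ) :
    orthChart e he (z, s) ∈ subgraph e h ↔ s < h z := by
  simp only [subgraph, mem_ofPred_eq, inner_orthChart, projection_orthChart]

theorem projection_graphMap (he : ‖e‖ = 1) (z : (Submodule.span ℝ {e})ᗮ) :
    (Submodule.span ℝ {e})ᗮ.orthogonalProjectionOnto (graphMap e h z) = z := by
  rw [← orthChart_height he, projection_orthChart]

theorem inner_graphMap (he : ‖e‖ = 1) (z : (Submodule.span ℝ {e})ᗮ) :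
    inner ℝ e (graphMap e h z) = h z := by
  rw [← orthChart_height he, inner_orthChart]

theorem mem_range_graphMap_iff (he : ‖e‖ = 1) {y : Space d} :
    y ∈ range (graphMap e h) ↔
      inner ℝ e y = h ((Submodule.span ℝ {e})ᗮ.orthogonalProjectionOnto y) := by
  constructor
  · rintro ⟨z, rfl⟩
    rw [inner_graphMap he, projection_graphMap he]
  · intro hy
    refine ⟨(Submodule.span ℝ {e})ᗮ.orthogonalProjectionOnto y, ?_⟩
    obtain ⟨⟨z, s⟩, rfl⟩ := (orthChart e he).surjective y
    rw [inner_orthChart, projection_orthChart] at hy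
    rw [projection_orthChart, ← orthChart_height he, ← hy]

theorem lipschitzWith_graphMap (he : ‖e‖ = 1) (hh : LipschitzWith K h) :
    LipschitzWith (1 + K) (graphMap e h) := by
  refine LipschitzWith.of_dist_le_mul fun z w => ?_
  rw [dist_eq_norm]
  have h1 : graphMap e h z - graphMap e h w = ((z - w : (Submodule.span ℝ {e})ᗮ) : Space d) +
      (h z - h w) • e := by
    simp only [graphMap, Submodule.coe_sub, sub_smul]
    abel
  have h2 := hh.dist_le_mul z w
  rw [Real.dist_eq] at h2
  rw [h1]
  calc _ ≤ ‖((z - w : (Submodule.span ℝ {e})ᗮ) : Space d)‖ + ‖(h z - h w) • e‖ := norm_add_le _ _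
    _ = dist z w + |h z - h w| := by
        rw [norm_smul, he, mul_one, dist_eq_norm, Submodule.coe_norm, Real.norm_eq_abs]
    _ ≤ dist z w + K * dist z w := by gcongr
    _ = ((1 + K : NNReal) : ℝ) * dist z w := by push_cast; ring

theorem euclideanHausdorffMeasure_image_le {X Y : Type*} [EMetricSpace X] [MeasurableSpace X]
    [BorelSpace X] [EMetricSpace Y] [MeasurableSpace Y] [BorelSpace Y] {L : NNReal} {f : X → Y}
    (hf : LipschitzWith L f) (n : ℕ) (s : Set X) :
    (Measure.euclideanHausdorffMeasure n : Measure Y) (f '' s) ≤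
      (L : ENNReal) ^ n * (Measure.euclideanHausdorffMeasure n : Measure X) s := by
  simp only [Measure.euclideanHausdorffMeasure_def, Measure.smul_apply, ENNReal.smul_def,
    smul_eq_mul]
  rw [mul_left_comm]
  gcongr
  simpa using hf.hausdorffMeasure_image_le (d := n) (by positivity) s

theorem euclideanHausdorffMeasure_orthogonal_eq_volume (he : ‖e‖ = 1) :
    (Measure.euclideanHausdorffMeasure (d - 1) : Measure (Submodule.span ℝ {e})ᗮ) = volume := by
  -- Since e spans a line, the dimensions of the line and its complement add up to d with 1 ≤ d, and
  -- the truncated subtraction d - 1 is exact.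
  have he0 : e ≠ 0 := fun h0 => by simp [h0] at he
  have h1 := (Submodule.span ℝ {e}).finrank_add_finrank_orthogonal
  rw [finrank_span_singleton he0, finrank_euclideanSpace_fin] at h1
  have h2 : d - 1 = Module.finrank ℝ (Submodule.span ℝ {e})ᗮ := by omega
  rw [h2, InnerProductSpace.euclideanHausdorffMeasure_eq_volume]

/-- The projection is a 1-Lipschitz left inverse of the graph map, so it does not increase Hausdorff
measure. With the converse bound from the (1 + K)-Lipschitz graph map, this replaces the area
formula: comparability is enough for trace estimates. -/
theorem map_graphMap_le (he : ‖e‖ = 1) (hh : LipschitzWith K h) :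
    (volume.map (graphMap e h)) ≤
      (Measure.euclideanHausdorffMeasure (d - 1)).restrict (range (graphMap e h)) := by
  refine Measure.le_iff.2 fun A hA => ?_
  rw [Measure.map_apply (lipschitzWith_graphMap he hh).continuous.measurable hA,
    Measure.restrict_apply hA, ← euclideanHausdorffMeasure_orthogonal_eq_volume he]
  have h1 : graphMap e h ⁻¹' A =
      (Submodule.span ℝ {e})ᗮ.orthogonalProjectionOnto '' (A ∩ range (graphMap e h)) := by
    ext z
    constructor
    · exact fun hz => ⟨graphMap e h z, ⟨hz, z, rfl⟩, projection_graphMap he z⟩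
    · rintro ⟨_, ⟨hy, w, rfl⟩, rfl⟩
      rwa [projection_graphMap he]
  have h2 : LipschitzWith 1 (Submodule.span ℝ {e})ᗮ.orthogonalProjectionOnto := by
    refine LipschitzWith.of_dist_le_mul fun y w => ?_
    rw [dist_eq_norm, dist_eq_norm, ← map_sub, NNReal.coe_one, one_mul]
    exact Submodule.norm_orthogonalProjectionOnto_apply_le _ _
  rw [h1]
  simpa using euclideanHausdorffMeasure_image_le h2 (d - 1) (A ∩ range (graphMap e h))

theorem restrict_range_graphMap_le (he : ‖e‖ = 1) (hh : LipschitzWith K h) :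
    (Measure.euclideanHausdorffMeasure (d - 1)).restrict (range (graphMap e h)) ≤
      (((1 + K : NNReal) : ENNReal) ^ (d - 1)) • (volume.map (graphMap e h)) := by
  refine Measure.le_iff.2 fun A hA => ?_
  rw [Measure.smul_apply, Measure.map_apply (lipschitzWith_graphMap he hh).continuous.measurable hA,
    Measure.restrict_apply hA, ← euclideanHausdorffMeasure_orthogonal_eq_volume he,
    ← image_preimage_eq_inter_range]
  exact euclideanHausdorffMeasure_image_le (lipschitzWith_graphMap he hh) _ _

theorem isOpen_subgraph (hh : LipschitzWith K h) : IsOpen (subgraph e h) :=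
  isOpen_lt (by fun_prop) (hh.continuous.comp (by fun_prop))

theorem hasCompactSupport_comp_graphMap (he : ‖e‖ = 1) {η : Space d → ℝ}
    (hη : HasCompactSupport η) : HasCompactSupport fun z => η (graphMap e h z) := by
  refine HasCompactSupport.intro (K := (Submodule.span ℝ {e})ᗮ.orthogonalProjectionOnto ''
    tsupport η) (hη.isCompact.image (by fun_prop)) fun z hz => ?_
  by_contra hne
  exact hz ⟨graphMap e h z, subset_tsupport _ hne, projection_graphMap he z⟩

/-- The divergence theorem on a subgraph, in the vertical direction. -/
theorem setIntegral_subgraph_fderiv (he : ‖e‖ = 1) (hh : LipschitzWith K h) {η : Space d → ℝ}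
    (hη : ContDiff ℝ 1 η) (hη' : HasCompactSupport η) :
    ∫ y in subgraph e h, fderiv ℝ η y e = ∫ z, η (graphMap e h z) := by
  have hU := (isOpen_subgraph (e := e) hh).measurableSet
  have hc : Continuous fun y => fderiv ℝ η y e :=
    (hη.continuous_fderiv (by simp)).clm_apply continuous_const
  have hi : Integrable fun y => fderiv ℝ η y e :=
    hc.integrable_of_hasCompactSupport (hη'.fderiv_apply (𝕜 := ℝ) e)
  rw [← integral_indicator hU, integral_eq_integral_orthChart he (hi.indicator hU)]
  refine integral_congr_ae (Filter.Eventually.of_forall fun z => ?_)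
  have hder : ∀ s, HasDerivAt (fun s : ℝ => η (orthChart e he (z, s)))
      (fderiv ℝ η (orthChart e he (z, s)) e) s := by
    intro s
    simp only [orthChart_apply]
    have h1 : HasDerivAt (fun s : ℝ => (z : Space d) + s • e) e s := by
      simpa using ((hasDerivAt_id s).smul_const e).const_add (z : Space d)
    exact (hη.differentiable (by simp) _).hasFDerivAt.comp_hasDerivAt s h1
  have hsm : ContDiff ℝ 1 fun s : ℝ => η (orthChart e he (z, s)) := by
    simp only [orthChart_apply]
    exact hη.comp (contDiff_const.add (contDiff_id.smul contDiff_const))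
  have hcs : HasCompactSupport fun s : ℝ => η (orthChart e he (z, s)) := by
    refine HasCompactSupport.intro (K := (fun y => inner ℝ e y) '' tsupport η)
      (hη'.isCompact.image (by fun_prop)) fun s hs => ?_
    by_contra hne
    exact hs ⟨_, subset_tsupport _ hne, inner_orthChart he (z, s)⟩
  -- The fundamental theorem of calculus on each vertical half-line below the graph.
  have hftc := HasCompactSupport.integral_Iic_deriv_eq hsm hcs (h z)
  rw [orthChart_height he, integral_Iic_eq_integral_Iio, ← integral_indicator measurableSet_Iio]
    at hftc
  simp only [← hftc]
  refine integral_congr_ae (Filter.Eventually.of_forall fun s => ?_)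
  simp only [indicator, orthChart_mem_subgraph, mem_Iio, (hder s).deriv]

/-- The mass of a Lipschitz function in a thin strip around a graph. -/
theorem lintegral_strip_le (he : ‖e‖ = 1) (hh : LipschitzWith K h) {η : Space d → ℝ}
    {L : NNReal} (hη : LipschitzWith L η) {δ : ℝ} :
    ∫⁻ y in {y | |inner ℝ e y - h ((Submodule.span ℝ {e})ᗮ.orthogonalProjectionOnto y)| ≤ δ},
        ‖η y‖ₑ ≤
      ENNReal.ofReal (2 * δ) * ((∫⁻ z, ‖η (graphMap e h z)‖ₑ) +
        ENNReal.ofReal (L * δ) *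
          volume ((Submodule.span ℝ {e})ᗮ.orthogonalProjectionOnto '' tsupport η)) := by
  set S := {y : Space d | |inner ℝ e y -
    h ((Submodule.span ℝ {e})ᗮ.orthogonalProjectionOnto y)| ≤ δ} with hS
  set D := (Submodule.span ℝ {e})ᗮ.orthogonalProjectionOnto '' tsupport η with hD
  have hSm : MeasurableSet S :=
    (isClosed_le (((by fun_prop : Continuous fun y : Space d => inner ℝ e y).sub
      (hh.continuous.comp (by fun_prop))).abs) continuous_const).measurableSet
  have hηm : Measurable fun y => ‖η y‖ₑ := hη.continuous.enorm.measurable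
  rw [← lintegral_indicator hSm, lintegral_eq_lintegral_orthChart he (hηm.indicator hSm)]
  -- Each vertical slice of the strip has length 2δ, and on it η differs from its value on the graph
  -- by at most L δ. The indicator of the shadow D of the support keeps that error integrable in z.
  have hin : ∀ z : (Submodule.span ℝ {e})ᗮ,
      ∫⁻ s : ℝ, S.indicator (fun y => ‖η y‖ₑ) (orthChart e he (z, s)) ≤
        ENNReal.ofReal (2 * δ) * (‖η (graphMap e h z)‖ₑ +
          ENNReal.ofReal (L * δ) * D.indicator 1 z) := by
    intro z
    have hpt : ∀ s : ℝ, S.indicator (fun y => ‖η y‖ₑ) (orthChart e he (z, s)) ≤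
        (Icc (h z - δ) (h z + δ)).indicator (fun _ => ‖η (graphMap e h z)‖ₑ +
          ENNReal.ofReal (L * δ) * D.indicator 1 z) s := by
      intro s
      by_cases hs : orthChart e he (z, s) ∈ S
      · have hs' : |s - h z| ≤ δ := by
          simpa only [hS, mem_ofPred_eq, inner_orthChart, projection_orthChart] using hs
        have hsI : s ∈ Icc (h z - δ) (h z + δ) := by
          have := abs_le.1 hs'
          exact ⟨by linarith, by linarith⟩
        rw [indicator_of_mem hs, indicator_of_mem hsI]
        by_cases h0 : η (orthChart e he (z, s)) = 0
        · simp [h0]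
        · have hzD : z ∈ D := ⟨_, subset_tsupport _ h0, projection_orthChart he (z, s)⟩
          rw [indicator_of_mem hzD, Pi.one_apply, mul_one]
          have h1 : dist (orthChart e he (z, s)) (graphMap e h z) ≤ δ := by
            rw [orthChart_apply, graphMap, dist_add_left, dist_eq_norm, ← sub_smul, norm_smul,
              he, mul_one]
            exact hs'
          have h2 := hη.dist_le_mul (orthChart e he (z, s)) (graphMap e h z)
          rw [← ofReal_norm, ← ofReal_norm, ← ENNReal.ofReal_add (norm_nonneg _)
            (mul_nonneg L.coe_nonneg (dist_nonneg.trans h1))]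
          refine ENNReal.ofReal_le_ofReal ?_
          have h3 : (L : ℝ) * dist (orthChart e he (z, s)) (graphMap e h z) ≤ L * δ := by gcongr
          have h4 := norm_le_norm_add_norm_sub' (η (orthChart e he (z, s))) (η (graphMap e h z))
          rw [dist_eq_norm] at h2
          linarith
      · rw [indicator_of_notMem hs]
        exact zero_le
    refine (lintegral_mono hpt).trans ?_
    rw [lintegral_indicator measurableSet_Icc, lintegral_const, Measure.restrict_apply_univ,
      Real.volume_Icc, mul_comm]
    gcongr
    linarith
  refine (lintegral_mono hin).trans ?_
  have hgm : Measurable fun z => ‖η (graphMap e h z)‖ₑ :=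
    (hη.continuous.comp (lipschitzWith_graphMap he hh).continuous).enorm.measurable
  rw [lintegral_const_mul' _ _ ENNReal.ofReal_ne_top, lintegral_add_left hgm,
    lintegral_const_mul' _ _ ENNReal.ofReal_ne_top]
  have hD1 : ∫⁻ z, D.indicator 1 z ≤ volume D := lintegral_indicator_one_le D
  gcongr

/-- The signed vertical distance to the graph is (1 + K)-Lipschitz, and its strict negativity
differs at y and y - t • ξ. At y it is therefore no larger in absolute value than its possible
variation. -/
theorem mem_strip_of_mem_symmDiff (he : ‖e‖ = 1) (hh : LipschitzWith K h) {y ξ : Space d} {t : ℝ}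
    (hy : ¬ (y - t • ξ ∈ subgraph e h ↔ y ∈ subgraph e h)) :
    |inner ℝ e y - h ((Submodule.span ℝ {e})ᗮ.orthogonalProjectionOnto y)| ≤
      (1 + K) * ‖ξ‖ * |t| := by
  simp only [subgraph, mem_ofPred_eq] at hy
  have h1 := hh.dist_le_mul
    ((Submodule.span ℝ {e})ᗮ.orthogonalProjectionOnto (y - t • ξ))
    ((Submodule.span ℝ {e})ᗮ.orthogonalProjectionOnto y)
  have h2 : dist ((Submodule.span ℝ {e})ᗮ.orthogonalProjectionOnto (y - t • ξ))
    ((Submodule.span ℝ {e})ᗮ.orthogonalProjectionOnto y) ≤ ‖ξ‖ * |t| := by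
    rw [dist_eq_norm, ← map_sub]
    refine (Submodule.norm_orthogonalProjectionOnto_apply_le _ _).trans ?_
    rw [sub_sub_cancel_left, norm_neg, norm_smul, mul_comm, Real.norm_eq_abs]
  have h3 : |inner ℝ e (y - t • ξ) - inner ℝ e y| ≤ ‖ξ‖ * |t| := by
    rw [← inner_sub_right, sub_sub_cancel_left, ← Real.norm_eq_abs]
    refine (norm_inner_le_norm _ _).trans ?_
    rw [norm_neg, norm_smul, he, one_mul, mul_comm, Real.norm_eq_abs]
  have h4 : (K : ℝ) * dist ((Submodule.span ℝ {e})ᗮ.orthogonalProjectionOnto (y - t • ξ))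
    ((Submodule.span ℝ {e})ᗮ.orthogonalProjectionOnto y) ≤ K * (‖ξ‖ * |t|) := by gcongr
  rw [Real.dist_eq] at h1
  have h5 := abs_le.1 (h1.trans h4)
  have h6 := abs_le.1 h3
  rw [abs_le]
  by_cases hm : inner ℝ e y < h ((Submodule.span ℝ {e})ᗮ.orthogonalProjectionOnto y)
  · have hn : ¬ inner ℝ e (y - t • ξ) <
        h ((Submodule.span ℝ {e})ᗮ.orthogonalProjectionOnto (y - t • ξ)) := fun hc =>
      hy (iff_of_true hc hm)
    constructor <;> nlinarith [h5.1, h5.2, h6.1, h6.2]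
  · have hn : inner ℝ e (y - t • ξ) <
        h ((Submodule.span ℝ {e})ᗮ.orthogonalProjectionOnto (y - t • ξ)) := by
      by_contra hc
      exact hy (iff_of_false hc hm)
    constructor <;> nlinarith [h5.1, h5.2, h6.1, h6.2]

end GraphChart

/-! ### The divergence theorem on a subgraph in arbitrary directions -/

section GraphGreen

open scoped Pointwise

variable {d : ℕ} {e : Space d} {K : NNReal} {h : (Submodule.span ℝ {e})ᗮ → ℝ}

/-- The integral of a directional derivative becomes a difference quotient of translates. No
regularity of U or normal vector enters. -/
theorem hasDerivAt_setIntegral_translate {U : Set (Space d)} {η : Space d → ℝ}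
    (hη : ContDiff ℝ 1 η) (hη' : HasCompactSupport η) (ξ : Space d) :
    HasDerivAt (fun t : ℝ => ∫ y in U, η (y + t • ξ)) (∫ y in U, fderiv ℝ η y ξ) 0 := by
  have hc : Continuous fun y => fderiv ℝ η y ξ :=
    (hη.continuous_fderiv (by simp)).clm_apply continuous_const
  have hcs : HasCompactSupport fun y => fderiv ℝ η y ξ := hη'.fderiv_apply (𝕜 := ℝ) ξ
  obtain ⟨C, hC⟩ := hcs.exists_bound_of_continuous hc
  -- This compact set contains the supports of all translates with |t| < 1, so the constant C on A
  -- dominates.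
  set A : Set (Space d) := tsupport η + Metric.closedBall 0 ‖ξ‖ with hA
  have hAc : IsCompact A := hη'.isCompact.add (isCompact_closedBall _ _)
  have key := hasDerivAt_integral_of_dominated_loc_of_deriv_le (μ := volume.restrict U)
    (F := fun (t : ℝ) y => η (y + t • ξ)) (F' := fun (t : ℝ) y => fderiv ℝ η (y + t • ξ) ξ)
    (x₀ := 0) (s := Metric.ball 0 1) (bound := A.indicator fun _ => C)
    (Metric.ball_mem_nhds _ one_pos)
    (Filter.Eventually.of_forall fun t =>
      (hη.continuous.comp (by fun_prop)).aestronglyMeasurable)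
    (by simpa using (hη.continuous.integrable_of_hasCompactSupport hη').restrict)
    (by simpa using hc.aestronglyMeasurable)
    (Filter.Eventually.of_forall fun y t ht => ?_)
    (IntegrableOn.integrable_indicator
      (continuous_const.continuousOn.integrableOn_compact hAc) hAc.measurableSet).restrict
    (Filter.Eventually.of_forall fun y t _ => ?_)
  · simpa using key.2
  · by_cases hy : y ∈ A
    · rw [indicator_of_mem hy]
      exact hC _
    · have h0 : y + t • ξ ∉ tsupport η := fun hmem => hy
        ⟨_, hmem, -(t • ξ), by
          rw [mem_closedBall_zero_iff, norm_neg, norm_smul]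
          have : ‖t‖ < 1 := mem_ball_zero_iff.1 ht
          nlinarith [norm_nonneg ξ], by simp⟩
      have h1 : fderiv ℝ η (y + t • ξ) = 0 := by
        by_contra hne
        exact h0 (support_fderiv_subset ℝ hne)
      simp [h1, hy]
  · have h1 : HasDerivAt (fun t : ℝ => y + t • ξ) ξ t := by
      simpa using ((hasDerivAt_id t).smul_const ξ).const_add y
    exact (hη.differentiable (by simp) _).hasFDerivAt.comp_hasDerivAt t h1

/-- A change of variables translates the domain instead of the function, and the two integrals then
differ only over the symmetric difference of the domains, which lies in a strip. -/
theorem enorm_setIntegral_translate_sub_le (he : ‖e‖ = 1) (hh : LipschitzWith K h)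
    {η : Space d → ℝ} (hη : Continuous η) (hη' : HasCompactSupport η) (ξ : Space d) (t : ℝ) :
    ‖(∫ y in subgraph e h, η (y + t • ξ)) - ∫ y in subgraph e h, η y‖ₑ ≤
      ∫⁻ y in {y | |inner ℝ e y - h ((Submodule.span ℝ {e})ᗮ.orthogonalProjectionOnto y)| ≤
        (1 + K) * ‖ξ‖ * |t|}, ‖η y‖ₑ := by
  have hU := (isOpen_subgraph (e := e) hh).measurableSet
  have hi : Integrable η := hη.integrable_of_hasCompactSupport hη'
  set S := {y : Space d | |inner ℝ e y -
    h ((Submodule.span ℝ {e})ᗮ.orthogonalProjectionOnto y)| ≤ (1 + K) * ‖ξ‖ * |t|} with hS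
  have hSm : MeasurableSet S :=
    (isClosed_le (((by fun_prop : Continuous fun y : Space d => inner ℝ e y).sub
      (hh.continuous.comp (by fun_prop))).abs) continuous_const).measurableSet
  have h1 : ∫ y in subgraph e h, η (y + t • ξ) =
      ∫ y, {y | y - t • ξ ∈ subgraph e h}.indicator η y := by
    rw [← integral_indicator hU, ← integral_sub_right_eq_self _ (t • ξ)]
    refine integral_congr_ae (Filter.Eventually.of_forall fun y => ?_)
    simp [indicator]
  have hUt : MeasurableSet {y | y - t • ξ ∈ subgraph e h} :=
    hU.preimage (by fun_prop)
  rw [h1, ← integral_indicator hU, ← integral_sub (hi.indicator hUt) (hi.indicator hU),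
    ← lintegral_indicator hSm]
  refine (enorm_integral_le_lintegral_enorm _).trans (lintegral_mono fun y => ?_)
  by_cases hy : y - t • ξ ∈ subgraph e h ↔ y ∈ subgraph e h
  · by_cases hy' : y ∈ subgraph e h <;> simp [hy, hy', indicator]
  · have hyS : y ∈ S := mem_strip_of_mem_symmDiff he hh hy
    by_cases hy' : y ∈ subgraph e h
    · have : ¬ y - t • ξ ∈ subgraph e h := fun hc => hy (iff_of_true hc hy')
      simp [indicator, hy', this, hyS]
    · have : y - t • ξ ∈ subgraph e h := by
        by_contra hc
        exact hy (iff_of_false hc hy')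
      simp [indicator, hy', this, hyS]

/-- The divergence theorem on a subgraph, as an inequality, in an arbitrary direction. -/
theorem abs_setIntegral_subgraph_fderiv_le (he : ‖e‖ = 1) (hh : LipschitzWith K h)
    {η : Space d → ℝ} (hη : ContDiff ℝ 1 η) (hη' : HasCompactSupport η) (ξ : Space d) :
    |∫ y in subgraph e h, fderiv ℝ η y ξ| ≤
      2 * ((1 + K) * ‖ξ‖) * ∫ z, |η (graphMap e h z)| := by
  obtain ⟨L, hL⟩ := hη.lipschitzWith_of_hasCompactSupport hη' (by simp)
  set M := ∫ z, |η (graphMap e h z)| with hM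
  set A := (1 + (K : ℝ)) * ‖ξ‖ with hA
  have hA0 : 0 ≤ A := by positivity
  set D := (Submodule.span ℝ {e})ᗮ.orthogonalProjectionOnto '' tsupport η with hD
  have hDv : volume D ≠ ⊤ := (hη'.isCompact.image (by fun_prop)).measure_ne_top
  have hMi : Integrable fun z => η (graphMap e h z) :=
    (hη.continuous.comp (lipschitzWith_graphMap he hh).continuous).integrable_of_hasCompactSupport
      (hasCompactSupport_comp_graphMap he hη')
  have hMe : ∫⁻ z, ‖η (graphMap e h z)‖ₑ = ENNReal.ofReal M := by
    rw [hM, ofReal_integral_eq_lintegral_ofReal hMi.abs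
      (Filter.Eventually.of_forall fun _ => abs_nonneg _)]
    refine lintegral_congr fun z => ?_
    rw [← ofReal_norm, Real.norm_eq_abs]
  have hM0 : 0 ≤ M := integral_nonneg fun _ => abs_nonneg _
  -- The strip has half-width A|t|, hence the factor 2 A after division by |t|. The Lipschitz error
  -- is of order |t| and disappears in the limit.
  have hbound : ∀ t : ℝ, |t⁻¹ * ((∫ y in subgraph e h, η (y + (0 + t) • ξ)) -
      ∫ y in subgraph e h, η (y + (0 : ℝ) • ξ))| ≤
      2 * A * (M + L * (A * |t|) * (volume D).toReal) := by
    intro t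
    have h1 := (enorm_setIntegral_translate_sub_le he hh hη.continuous hη' ξ t).trans
      (lintegral_strip_le he hh hL)
    rw [← hA, ← hD, hMe, ← ENNReal.ofReal_toReal hDv, ← ENNReal.ofReal_mul (by positivity),
      ← ENNReal.ofReal_add hM0 (by positivity), ← ENNReal.ofReal_mul (by positivity),
      ← ofReal_norm, ENNReal.ofReal_le_ofReal_iff (by positivity), Real.norm_eq_abs] at h1
    simp only [zero_add, zero_smul, add_zero]
    rcases eq_or_ne t 0 with rfl | ht
    · simp only [inv_zero, zero_mul, abs_zero]
      positivity
    · rw [abs_mul, abs_inv, inv_mul_le_iff₀ (abs_pos.2 ht)]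
      refine h1.trans (le_of_eq ?_)
      ring
  have hlim := (hasDerivAt_setIntegral_translate (U := subgraph e h) hη hη' ξ).tendsto_slope_zero
  have hlim2 : Filter.Tendsto (fun t : ℝ => 2 * A * (M + L * (A * |t|) * (volume D).toReal))
      (𝓝[≠] 0) (𝓝 (2 * A * M)) := by
    have : Continuous fun t : ℝ => 2 * A * (M + L * (A * |t|) * (volume D).toReal) := by fun_prop
    have h2 := this.tendsto 0
    simp only [abs_zero, mul_zero, zero_mul, add_zero] at h2
    exact h2.mono_left nhdsWithin_le_nhds
  exact le_of_tendsto_of_tendsto' hlim.abs hlim2 hbound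

end GraphGreen

/-! ### From graphs to the boundary of Ω -/

section Surface

variable {d : ℕ} {Ω B : Set (Space d)} {e : Space d} {K : NNReal}
  {h : (Submodule.span ℝ {e})ᗮ → ℝ}

theorem IsSubgraphIn.inter_eq (hg : IsSubgraphIn Ω B e K h) : Ω ∩ B = subgraph e h ∩ B := by
  ext y
  exact and_congr_left fun hy => hg.mem_iff y hy

/-- A boundary point is neither strictly above the graph, since it is in the closure, nor strictly
below, since Ω is open. Conversely, a point of the graph is the limit of points of Ω lying
vertically below it. -/
theorem IsSubgraphIn.frontier_inter_eq (hg : IsSubgraphIn Ω B e K h) (hB : IsOpen B)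
    (hΩ : IsOpen Ω) : frontier Ω ∩ B = range (graphMap e h) ∩ B := by
  ext y
  refine and_congr_left fun hy => ?_
  rw [mem_range_graphMap_iff hg.norm_eq_one, hΩ.frontier_eq]
  constructor
  · rintro ⟨h1, h2⟩
    exact le_antisymm (hg.inner_le_of_mem_closure hB hy h1)
      (not_lt.1 fun hlt => h2 ((hg.mem_iff y hy).2 hlt))
  · intro heq
    refine ⟨?_, fun hyΩ => ((hg.mem_iff y hy).1 hyΩ).ne heq⟩
    have hc : Continuous fun t : ℝ => y - t • e := by fun_prop
    have hlim : Filter.Tendsto (fun t : ℝ => y - t • e) (𝓝[>] 0) (𝓝 y) := by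
      simpa using (hc.tendsto 0).mono_left (nhdsWithin_le_nhds (s := Ioi 0))
    refine mem_closure_of_tendsto hlim ?_
    filter_upwards [hlim.eventually (hB.mem_nhds hy), self_mem_nhdsWithin] with t ht ht0
    rw [hg.mem_iff _ ht, map_sub, map_smul, projection_self, smul_zero, sub_zero, inner_sub_right,
      real_inner_smul_right, real_inner_self_eq_norm_sq, hg.norm_eq_one, heq]
    have : 0 < t := ht0
    linarith

theorem setIntegral_eq_of_inter_eq {S T : Set (Space d)} (hS : MeasurableSet S)
    (hT : MeasurableSet T) (h : S ∩ B = T ∩ B) {F : Space d → ℝ} (hF : ∀ x ∉ B, F x = 0) :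
    ∫ x in S, F x = ∫ x in T, F x := by
  rw [← integral_indicator hS, ← integral_indicator hT]
  refine integral_congr_ae (Filter.Eventually.of_forall fun x => ?_)
  by_cases hx : x ∈ B
  · have : x ∈ S ↔ x ∈ T := by
      have := congrArg (x ∈ ·) h
      simpa [hx] using this
    by_cases hxS : x ∈ S
    · rw [indicator_of_mem hxS, indicator_of_mem (this.1 hxS)]
    · rw [indicator_of_notMem hxS, indicator_of_notMem fun hxT => hxS (this.2 hxT)]
  · simp [indicator, hF x hx]

theorem lintegral_restrict_eq_of_inter_eq (μ : Measure (Space d)) {S T : Set (Space d)}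
    (hB : MeasurableSet B) (h : S ∩ B = T ∩ B) {F : Space d → ENNReal} (hF : ∀ x ∉ B, F x = 0) :
    ∫⁻ x, F x ∂μ.restrict S = ∫⁻ x, F x ∂μ.restrict T := by
  have hind : F = B.indicator F := by
    funext x
    by_cases hx : x ∈ B <;> simp [hx, hF]
  rw [hind, lintegral_indicator hB, lintegral_indicator hB, Measure.restrict_restrict hB,
    Measure.restrict_restrict hB, inter_comm, h, inter_comm]

theorem IsSubgraphIn.lintegral_graphMap_le (hg : IsSubgraphIn Ω B e K h) (hB : IsOpen B)
    (hΩ : IsOpen Ω) {F : Space d → ENNReal} (hFm : Measurable F) (hF : ∀ x ∉ B, F x = 0) :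
    ∫⁻ z, F (graphMap e h z) ≤ ∫⁻ x, F x ∂surface Ω := by
  rw [surface, lintegral_restrict_eq_of_inter_eq _ hB.measurableSet
    (hg.frontier_inter_eq hB hΩ) hF, ← lintegral_map hFm
      (lipschitzWith_graphMap hg.norm_eq_one hg.lipschitzWith).continuous.measurable]
  exact lintegral_mono' (map_graphMap_le hg.norm_eq_one hg.lipschitzWith) le_rfl

theorem IsSubgraphIn.lintegral_surface_le (hg : IsSubgraphIn Ω B e K h) (hB : IsOpen B)
    (hΩ : IsOpen Ω) {F : Space d → ENNReal} (hFm : Measurable F) (hF : ∀ x ∉ B, F x = 0) :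
    ∫⁻ x, F x ∂surface Ω ≤
      ((1 + K : NNReal) : ENNReal) ^ (d - 1) * ∫⁻ z, F (graphMap e h z) := by
  rw [surface, lintegral_restrict_eq_of_inter_eq _ hB.measurableSet
    (hg.frontier_inter_eq hB hΩ) hF, ← lintegral_map hFm
      (lipschitzWith_graphMap hg.norm_eq_one hg.lipschitzWith).continuous.measurable,
      ← smul_eq_mul, ← lintegral_smul_measure]
  exact lintegral_mono' (restrict_range_graphMap_le hg.norm_eq_one hg.lipschitzWith) le_rfl

end Surface

/-! ### The trace inequality; existence and uniqueness of traces -/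

section TraceInequality

variable {d : ℕ} {Ω : Set (Space d)}

/-- The support condition satisfied by the functions of a partition of unity. -/
def IsBoundaryCell (Ω S : Set (Space d)) : Prop :=
  S ⊆ Ω ∨ ∃ (x : Space d) (r : ℝ) (e : Space d) (K : NNReal)
    (h : (Submodule.span ℝ {e})ᗮ → ℝ), 0 < r ∧ S ⊆ Metric.ball x (r / 2) ∧
      IsSubgraphIn Ω (Metric.ball x r) e K h

theorem fderiv_eq_zero_of_notMem {S : Set (Space d)} {w : Space d → ℝ} (h : tsupport w ⊆ S)
    {x : Space d} (hx : x ∉ S) : fderiv ℝ w x = 0 := by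
  by_contra hne
  exact hx (h (support_fderiv_subset ℝ hne))

theorem lintegral_surface_eq_zero (hΩ : IsOpen Ω) {w : Space d → ℝ} (h : tsupport w ⊆ Ω) :
    ∫⁻ x, ‖w x‖ₑ ∂surface Ω = 0 := by
  rw [surface, setLIntegral_congr_fun (g := fun _ => 0) isClosed_frontier.measurableSet]
  · simp
  · intro x hx
    have hx' : x ∉ tsupport w := fun hmem => by
      rw [hΩ.frontier_eq] at hx
      exact hx.2 (h hmem)
    simp [image_eq_zero_of_notMem_tsupport hx']

theorem integral_fderiv_eq_zero {w : Space d → ℝ} (hw : ContDiff ℝ 1 w)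
    (hw' : HasCompactSupport w) (ξ : Space d) : ∫ x, fderiv ℝ w x ξ = 0 := by
  have h := integral_mul_inner_gradient (f := fun _ : Space d => (1 : ℝ)) contDiff_const hw hw' ξ
  simpa [inner_gradient_left, gradient_fun_const] using h

/-- Green's formula near the boundary, as an inequality. -/
theorem IsBoundaryCell.exists_enorm_setIntegral_fderiv_le {S : Set (Space d)}
    (hS : IsBoundaryCell Ω S) (hΩ : IsOpen Ω) (ξ : Space d) :
    ∃ C : NNReal, ∀ w : Space d → ℝ, ContDiff ℝ 1 w → HasCompactSupport w → tsupport w ⊆ S →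
      ‖∫ x in Ω, fderiv ℝ w x ξ‖ₑ ≤ C * ∫⁻ x, ‖w x‖ₑ ∂surface Ω := by
  rcases hS with hS | ⟨x, r, e, K, h, hr, hS, hg⟩
  -- A function supported inside Ω has derivatives of integral zero and no boundary values.
  · refine ⟨0, fun w hw hw' hws => ?_⟩
    rw [setIntegral_eq_integral_of_forall_compl_eq_zero fun x hx => by
      rw [fderiv_eq_zero_of_notMem (hws.trans hS) hx]; rfl, integral_fderiv_eq_zero hw hw']
    simp
  · refine ⟨Real.toNNReal (2 * ((1 + K) * ‖ξ‖)), fun w hw hw' hws => ?_⟩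
    have hB : tsupport w ⊆ Metric.ball x r :=
      (hws.trans hS).trans (Metric.ball_subset_ball (by linarith))
    have he := hg.norm_eq_one
    rw [setIntegral_eq_of_inter_eq hΩ.measurableSet (isOpen_subgraph hg.lipschitzWith).measurableSet
      hg.inter_eq fun y hy => by rw [fderiv_eq_zero_of_notMem hB hy]; rfl]
    have h1 := abs_setIntegral_subgraph_fderiv_le he hg.lipschitzWith hw hw' ξ
    have hMi : Integrable fun z => w (graphMap e h z) :=
      (hw.continuous.comp
        (lipschitzWith_graphMap he hg.lipschitzWith).continuous).integrable_of_hasCompactSupport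
        (hasCompactSupport_comp_graphMap he hw')
    have hMe : ∫⁻ z, ‖w (graphMap e h z)‖ₑ = ENNReal.ofReal (∫ z, |w (graphMap e h z)|) := by
      rw [ofReal_integral_eq_lintegral_ofReal hMi.abs
        (Filter.Eventually.of_forall fun _ => abs_nonneg _)]
      refine lintegral_congr fun z => ?_
      rw [← ofReal_norm, Real.norm_eq_abs]
    have h2 := hg.lintegral_graphMap_le Metric.isOpen_ball hΩ (F := fun y => ‖w y‖ₑ)
      hw.continuous.enorm.measurable fun y hy => by
        simp [image_eq_zero_of_notMem_tsupport fun hc => hy (hB hc)]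
    calc _ ≤ ENNReal.ofReal (2 * ((1 + K) * ‖ξ‖) * ∫ z, |w (graphMap e h z)|) := by
          rw [← ofReal_norm]
          exact ENNReal.ofReal_le_ofReal h1
      _ = (Real.toNNReal (2 * ((1 + K) * ‖ξ‖)) : ENNReal) * ∫⁻ z, ‖w (graphMap e h z)‖ₑ := by
          rw [ENNReal.ofReal_mul (by positivity), hMe]
          rfl
      _ ≤ _ := by gcongr

/-- The boundary integral of a nonnegative function is controlled by the integral of a
derivative. -/
theorem IsBoundaryCell.exists_lintegral_surface_le {S : Set (Space d)}
    (hS : IsBoundaryCell Ω S) (hΩ : IsOpen Ω) :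
    ∃ (C : NNReal) (e : Space d), ∀ w : Space d → ℝ, ContDiff ℝ 1 w → HasCompactSupport w →
      (∀ x, 0 ≤ w x) → tsupport w ⊆ S →
      ∫⁻ x, ‖w x‖ₑ ∂surface Ω ≤ C * ‖∫ x in Ω, fderiv ℝ w x e‖ₑ := by
  rcases hS with hS | ⟨x, r, e, K, h, hr, hS, hg⟩
  · refine ⟨0, 0, fun w _ _ _ hws => ?_⟩
    rw [lintegral_surface_eq_zero hΩ (hws.trans hS)]
    exact zero_le
  · refine ⟨(1 + K) ^ (d - 1), e, fun w hw hw' hw0 hws => ?_⟩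
    have hB : tsupport w ⊆ Metric.ball x r :=
      (hws.trans hS).trans (Metric.ball_subset_ball (by linarith))
    have he := hg.norm_eq_one
    rw [setIntegral_eq_of_inter_eq hΩ.measurableSet (isOpen_subgraph hg.lipschitzWith).measurableSet
      hg.inter_eq fun y hy => by rw [fderiv_eq_zero_of_notMem hB hy]; rfl,
      setIntegral_subgraph_fderiv he hg.lipschitzWith hw hw']
    have hMi : Integrable fun z => w (graphMap e h z) :=
      (hw.continuous.comp
        (lipschitzWith_graphMap he hg.lipschitzWith).continuous).integrable_of_hasCompactSupport
        (hasCompactSupport_comp_graphMap he hw')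
    -- Nonnegativity of w excludes cancellation, so the exact vertical divergence theorem controls
    -- the full mass on the graph.
    have hMe : ∫⁻ z, ‖w (graphMap e h z)‖ₑ = ‖∫ z, w (graphMap e h z)‖ₑ := by
      rw [Real.enorm_of_nonneg (integral_nonneg fun _ => hw0 _),
        ofReal_integral_eq_lintegral_ofReal hMi (Filter.Eventually.of_forall fun _ => hw0 _)]
      exact lintegral_congr fun z => Real.enorm_of_nonneg (hw0 _)
    rw [← hMe, ENNReal.coe_pow]
    exact hg.lintegral_surface_le Metric.isOpen_ball hΩ (F := fun y => ‖w y‖ₑ)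
      hw.continuous.enorm.measurable fun y hy => by
        simp [image_eq_zero_of_notMem_tsupport fun hc => hy (hB hc)]

/-- The boundary mass of θη² is controlled by the integral of its derivative η² ∂θ + 2θη ∂η, and
2|η||∇η| ≤ η² + |∇η|² absorbs the mixed term. -/
theorem exists_lintegral_mul_sq_le (hΩ : IsOpen Ω) {θ : Space d → ℝ}
    (hθ : IsTestFunction univ θ) (hθ0 : ∀ x, 0 ≤ θ x) (hS : IsBoundaryCell Ω (tsupport θ)) :
    ∃ C : NNReal, ∀ η : Space d → ℝ, ContDiff ℝ 1 η →
      ∫⁻ x, ‖θ x * η x ^ 2‖ₑ ∂surface Ω ≤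
        C * ∫⁻ x in Ω, (‖η x‖ₑ ^ 2 + ‖∇ η x‖ₑ ^ 2) := by
  obtain ⟨C₁, e, hC₁⟩ := hS.exists_lintegral_surface_le hΩ
  obtain ⟨C₂, hC₂⟩ := hθ.hasCompactSupport.exists_bound_of_continuous hθ.continuous
  obtain ⟨C₃, hC₃⟩ := (HasCompactSupport.intro hθ.hasCompactSupport fun _ hx =>
        gradient_eq_zero_of_notMem_tsupport hx).exists_bound_of_continuous hθ.continuous_gradient
  have hC₂0 : 0 ≤ C₂ := (norm_nonneg _).trans (hC₂ 0)
  have hC₃0 : 0 ≤ C₃ := (norm_nonneg _).trans (hC₃ 0)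
  refine ⟨C₁ * Real.toNNReal ((C₂ + C₃) * ‖e‖), fun η hη => ?_⟩
  have hθ1 : ContDiff ℝ 1 θ := hθ.smooth.of_le (by simp)
  have hcs : HasCompactSupport fun x => θ x * η x ^ 2 := hθ.hasCompactSupport.mul_right
  refine (hC₁ _ (hθ1.mul (hη.pow 2)) hcs (fun x => by have := hθ0 x; positivity)
    tsupport_mul_subset_left).trans ?_
  rw [ENNReal.coe_mul, mul_assoc]
  gcongr
  rw [← lintegral_const_mul' _ _ ENNReal.coe_ne_top]
  refine (enorm_integral_le_lintegral_enorm _).trans (lintegral_mono fun x => ?_)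
  have hder : fderiv ℝ (fun x => θ x * η x ^ 2) x e =
      η x ^ 2 * inner ℝ (∇ θ x) e + 2 * θ x * η x * inner ℝ (∇ η x) e := by
    have hp : DifferentiableAt ℝ (fun y => η y ^ 2) x := (hη.pow 2).differentiable (by simp) x
    rw [fderiv_fun_mul (hθ.differentiable x) hp,
      fderiv_fun_pow _ (hη.differentiable (by simp) x)]
    simp [inner_gradient_left]
    ring
  have hb1 : |inner ℝ (∇ θ x) e| ≤ C₃ * ‖e‖ := (abs_real_inner_le_norm _ _).trans (by
    gcongr; exact hC₃ x)
  have hb2 : |inner ℝ (∇ η x) e| ≤ ‖∇ η x‖ * ‖e‖ := abs_real_inner_le_norm _ _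
  have hb3 : |θ x| ≤ C₂ := hC₂ x
  have hb4 : 2 * (|η x| * ‖∇ η x‖) ≤ η x ^ 2 + ‖∇ η x‖ ^ 2 := by
    nlinarith [sq_nonneg (|η x| - ‖∇ η x‖), sq_abs (η x)]
  have hmain : ‖fderiv ℝ (fun x => θ x * η x ^ 2) x e‖ ≤
      (C₂ + C₃) * ‖e‖ * (η x ^ 2 + ‖∇ η x‖ ^ 2) := by
    rw [hder, Real.norm_eq_abs]
    calc _ ≤ |η x ^ 2 * inner ℝ (∇ θ x) e| + |2 * θ x * η x * inner ℝ (∇ η x) e| :=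
          abs_add_le _ _
      _ = η x ^ 2 * |inner ℝ (∇ θ x) e| + 2 * |θ x| * |η x| * |inner ℝ (∇ η x) e| := by
          simp only [abs_mul, abs_pow, sq_abs, abs_two]
      _ ≤ η x ^ 2 * (C₃ * ‖e‖) + 2 * C₂ * |η x| * (‖∇ η x‖ * ‖e‖) := by gcongr
      _ = η x ^ 2 * (C₃ * ‖e‖) + C₂ * ‖e‖ * (2 * (|η x| * ‖∇ η x‖)) := by ring
      _ ≤ (η x ^ 2 + ‖∇ η x‖ ^ 2) * (C₃ * ‖e‖) + C₂ * ‖e‖ * (η x ^ 2 + ‖∇ η x‖ ^ 2) := by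
          gcongr
          exact le_add_of_nonneg_right (by positivity)
      _ = _ := by ring
  rw [← ofReal_norm, ← ofReal_norm, ← ofReal_norm, ← ENNReal.ofReal_pow (norm_nonneg _),
    ← ENNReal.ofReal_pow (norm_nonneg _), ← ENNReal.ofReal_add (by positivity) (by positivity)]
  refine (ENNReal.ofReal_le_ofReal hmain).trans (le_of_eq ?_)
  rw [ENNReal.ofReal_mul (by positivity), Real.norm_eq_abs, sq_abs]
  rfl

/-- The trace inequality. -/
theorem IsBoundedLipschitzDomain.exists_lintegral_sq_le (hΩ : IsBoundedLipschitzDomain Ω) :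
    ∃ C : NNReal, ∀ η : Space d → ℝ, ContDiff ℝ 1 η →
      ∫⁻ x, ‖η x‖ₑ ^ 2 ∂surface Ω ≤ C * ∫⁻ x in Ω, (‖η x‖ₑ ^ 2 + ‖∇ η x‖ₑ ^ 2) := by
  obtain ⟨ι, _, θ, hθ, hθ0, hsum, hcase⟩ := hΩ.exists_partition
  choose C hC using fun i => exists_lintegral_mul_sq_le hΩ.isOpen (hθ i) (hθ0 i) (hcase i)
  refine ⟨∑ i, C i, fun η hη => ?_⟩
  have h1 : ∫⁻ x, ‖η x‖ₑ ^ 2 ∂surface Ω =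
      ∫⁻ x, ∑ i, ‖θ i x * η x ^ 2‖ₑ ∂surface Ω := by
    rw [surface]
    refine setLIntegral_congr_fun isClosed_frontier.measurableSet fun x hx => ?_
    have h2 : ∀ i, ‖θ i x * η x ^ 2‖ₑ = ENNReal.ofReal (θ i x) * ‖η x‖ₑ ^ 2 := fun i => by
      rw [enorm_mul, Real.enorm_of_nonneg (hθ0 i x), enorm_pow]
    simp only [h2]
    rw [← Finset.sum_mul, ← ENNReal.ofReal_sum_of_nonneg fun i _ => hθ0 i x,
      hsum x (frontier_subset_closure hx), ENNReal.ofReal_one, one_mul]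
  have hm : ∀ i, Measurable fun x => ‖θ i x * η x ^ 2‖ₑ := fun i =>
    ((hθ i).continuous.mul (hη.continuous.pow 2)).enorm.measurable
  rw [h1, lintegral_finsetSum _ fun i _ => hm i, ENNReal.ofNNReal_finsetSum, Finset.sum_mul]
  exact Finset.sum_le_sum fun i _ => hC i η hη

/-- The trace inequality for η = 1 bounds the surface area by a multiple of the volume of Ω. -/
theorem IsBoundedLipschitzDomain.isFiniteMeasure_surface (hΩ : IsBoundedLipschitzDomain Ω) :
    IsFiniteMeasure (surface Ω) := by
  obtain ⟨C, hC⟩ := hΩ.exists_lintegral_sq_le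
  have h := hC (fun _ => 1) contDiff_const
  simp only [gradient_fun_const, enorm_one, one_pow, enorm_zero, ne_eq, OfNat.ofNat_ne_zero,
    not_false_eq_true, zero_pow, add_zero, lintegral_one, Measure.restrict_apply_univ] at h
  exact ⟨h.trans_lt (ENNReal.mul_lt_top ENNReal.coe_lt_top hΩ.isBounded.measure_lt_top)⟩

theorem eLpNorm_two_sq {α E : Type*} [MeasurableSpace α] [NormedAddCommGroup E] (μ : Measure α)
    (u : α → E) : eLpNorm u 2 μ ^ 2 = ∫⁻ x, ‖u x‖ₑ ^ 2 ∂μ := by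
  have := eLpNorm_nnreal_pow_eq_lintegral (f := u) (p := 2) (μ := μ) (by norm_num)
  norm_cast at this
  simpa only [ENNReal.rpow_ofNat] using this

/-- The trace inequality for smooth functions, in `L²` norms. -/
theorem IsBoundedLipschitzDomain.exists_norm_le_of_mem_smoothTraceGraph
    (hΩ : IsBoundedLipschitzDomain Ω) :
    ∃ C : NNReal, ∀ p ∈ smoothTraceGraph Ω, ‖p.2.2‖ ≤ C * ‖(p.1, p.2.1)‖ := by
  obtain ⟨C, hC⟩ := hΩ.exists_lintegral_sq_le
  -- The product norm is a maximum, so the sum of the two squared norms is at most twice its square.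
  refine ⟨NNReal.sqrt (C * 2), ?_⟩
  rintro ⟨φ, G, f⟩ ⟨η, hη, h1, h2, h3⟩
  have hη1 : ContDiff ℝ 1 η := hη.of_le (by simp)
  have h := hC η hη1
  rw [lintegral_add_left (hη.continuous.enorm.measurable.pow_const 2), ← eLpNorm_two_sq,
    ← eLpNorm_two_sq, ← eLpNorm_two_sq, ← eLpNorm_congr_ae h1, ← eLpNorm_congr_ae h2,
    ← eLpNorm_congr_ae h3, ← Lp.enorm_def, ← Lp.enorm_def, ← Lp.enorm_def] at h
  simp only [enorm_eq_nnnorm] at h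
  norm_cast at h
  have h4 : ‖φ‖₊ ≤ ‖(φ, G)‖₊ := le_max_left _ _
  have h5 : ‖G‖₊ ≤ ‖(φ, G)‖₊ := le_max_right _ _
  have h6 : ‖f‖₊ ≤ NNReal.sqrt (C * 2) * ‖(φ, G)‖₊ := by
    rw [← pow_le_pow_iff_left₀ (zero_le) (zero_le) two_ne_zero, mul_pow, NNReal.sq_sqrt]
    calc ‖f‖₊ ^ 2 ≤ C * (‖φ‖₊ ^ 2 + ‖G‖₊ ^ 2) := h
      _ ≤ C * (‖(φ, G)‖₊ ^ 2 + ‖(φ, G)‖₊ ^ 2) := by gcongr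
      _ = _ := by ring
  exact NNReal.coe_le_coe.2 h6

theorem exists_norm_le_of_mem_closure_smoothTraceGraph (hΩ : IsBoundedLipschitzDomain Ω) :
    ∃ C : NNReal, ∀ p ∈ (smoothTraceGraph Ω).topologicalClosure,
      ‖p.2.2‖ ≤ C * ‖(p.1, p.2.1)‖ := by
  obtain ⟨C, hC⟩ := hΩ.exists_norm_le_of_mem_smoothTraceGraph
  refine ⟨C, fun p hp => ?_⟩
  have hcl : IsClosed {p : L2 Ω × L2Vec Ω × L2Bdry Ω | ‖p.2.2‖ ≤ C * ‖(p.1, p.2.1)‖} :=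
    isClosed_le (by fun_prop) (by fun_prop)
  exact closure_minimal hC hcl hp

theorem exists_mem_smoothTraceGraph_of_mem_testGraph (hΩ : IsBoundedLipschitzDomain Ω)
    {q : L2 Ω × L2Vec Ω} (hq : q ∈ testGraph univ Ω) :
    ∃ f : L2Bdry Ω, (q.1, q.2, f) ∈ smoothTraceGraph Ω := by
  obtain ⟨η, hη, h1, h2⟩ := hq
  have := hΩ.isFiniteMeasure_surface
  have hm : MemLp η 2 (surface Ω) :=
    hη.continuous.memLp_of_hasCompactSupport hη.hasCompactSupport
  exact ⟨hm.toLp η, η, hη.smooth, h1, h2, hm.coeFn_toLp⟩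

/-- Every `φ ∈ H¹(Ω)` has a trace. -/
theorem exists_hasTrace (hΩ : IsBoundedLipschitzDomain Ω) (φ : H1 Ω) :
    ∃ f : L2Bdry Ω, HasTrace φ f := by
  obtain ⟨C, hC⟩ := exists_norm_le_of_mem_closure_smoothTraceGraph hΩ
  set T := (smoothTraceGraph Ω).topologicalClosure with hT
  let π : (L2 Ω × L2Vec Ω × L2Bdry Ω) →L[ℝ] (L2 Ω × L2Vec Ω) :=
    (ContinuousLinearMap.fst ℝ _ _).prod
      ((ContinuousLinearMap.fst ℝ _ _).comp (ContinuousLinearMap.snd ℝ _ _))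
  let π' : T →L[ℝ] (L2 Ω × L2Vec Ω) := π.comp T.subtypeL
  have hTc : CompleteSpace T := (Submodule.isClosed_topologicalClosure _).completeSpace_coe
  have hanti : AntilipschitzWith (max 1 C) π' := by
    refine AddMonoidHomClass.antilipschitz_of_bound π' fun x => ?_
    have h1 := hC x.1 x.2
    have h2 : π' x = (x.1.1, x.1.2.1) := rfl
    rw [h2, Submodule.coe_norm]
    have h0 := norm_nonneg (x.1.1, x.1.2.1)
    have e1 : ‖x.1.1‖ ≤ ‖(x.1.1, x.1.2.1)‖ := norm_fst_le (x.1.1, x.1.2.1)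
    have e2 : ‖x.1.2.1‖ ≤ ‖(x.1.1, x.1.2.1)‖ := norm_snd_le (x.1.1, x.1.2.1)
    have e3 : ‖(x.1.1, x.1.2.1)‖ ≤ (max 1 C : NNReal) * ‖(x.1.1, x.1.2.1)‖ :=
      le_mul_of_one_le_left h0 (by exact_mod_cast le_max_left 1 C)
    have e4 : C * ‖(x.1.1, x.1.2.1)‖ ≤ (max 1 C : NNReal) * ‖(x.1.1, x.1.2.1)‖ := by
      gcongr
      exact le_max_right 1 C
    exact max_le (e1.trans e3) (max_le (e2.trans e3) (h1.trans e4))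
  have hcl : IsClosed (range π') := hanti.isClosed_range π'.uniformContinuous
  have hsub : ((testGraph univ Ω).topologicalClosure : Set (L2 Ω × L2Vec Ω)) ⊆ range π' := by
    refine closure_minimal (fun q hq => ?_) hcl
    obtain ⟨f, hf⟩ := exists_mem_smoothTraceGraph_of_mem_testGraph hΩ hq
    exact ⟨⟨(q.1, q.2, f), Submodule.le_topologicalClosure _ hf⟩, rfl⟩
  obtain ⟨⟨⟨a, b, f⟩, hx⟩, hx'⟩ := hsub (H1_le_closure_testGraph_univ hΩ φ.2)
  have h1 : a = fn φ := congrArg Prod.fst hx'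
  have h2 : b = grad φ := congrArg Prod.snd hx'
  exact ⟨f, by rw [HasTrace, ← h1, ← h2]; exact hx⟩

/-- Subtracting two triples leaves (0, 0, f - g), and the trace inequality bounds the last entry by
the first two. -/
theorem HasTrace.unique (hΩ : IsBoundedLipschitzDomain Ω) {φ : H1 Ω} {f g : L2Bdry Ω}
    (hf : HasTrace φ f) (hg : HasTrace φ g) : f = g := by
  obtain ⟨C, hC⟩ := exists_norm_le_of_mem_closure_smoothTraceGraph hΩ
  have h := hC _ (Submodule.sub_mem _ hf hg)
  simp only [Prod.mk_sub_mk, sub_self] at h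
  rw [← sub_eq_zero, ← norm_le_zero_iff]
  refine h.trans (le_of_eq ?_)
  simp

end TraceInequality

/-! ### H¹₀(Ω) as the kernel of the trace -/

section ZeroTrace

variable {d : ℕ} {Ω : Set (Space d)}

/-- Green's formula on `Ω`, as an inequality. -/
theorem IsBoundedLipschitzDomain.exists_enorm_setIntegral_fderiv_mul_le
    (hΩ : IsBoundedLipschitzDomain Ω) {κ : Space d → ℝ} (hκ : IsTestFunction univ κ)
    (ξ : Space d) :
    ∃ C : NNReal, ∀ η : Space d → ℝ, ContDiff ℝ 1 η →
      ‖∫ x in Ω, fderiv ℝ (fun y => κ y * η y) x ξ‖ₑ ≤ C * ∫⁻ x, ‖η x‖ₑ ∂surface Ω := by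
  obtain ⟨ι, _, θ, hθ, hθ0, hsum, hcase⟩ := hΩ.exists_partition
  choose C hC using fun i =>
    IsBoundaryCell.exists_enorm_setIntegral_fderiv_le (hcase i) hΩ.isOpen ξ
  have hκθ : ∀ i, IsTestFunction univ fun x => θ i x * κ x := fun i => hκ.mul_left (hθ i).smooth
  choose D hD using fun i =>
    (hκθ i).hasCompactSupport.exists_bound_of_continuous (hκθ i).continuous
  refine ⟨∑ i, C i * (D i).toNNReal, fun η hη => ?_⟩
  have hw : ∀ i, ContDiff ℝ 1 fun x => θ i x * κ x * η x := fun i =>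
    ((hκθ i).smooth.of_le (by simp)).mul hη
  have hwc : ∀ i, HasCompactSupport fun x => θ i x * κ x * η x := fun i =>
    (hκθ i).hasCompactSupport.mul_right
  -- The partition functions sum to 1 on Ω, so κη splits into pieces supported in single cells.
  have h1 : ∫ x in Ω, fderiv ℝ (fun y => κ y * η y) x ξ =
      ∑ i, ∫ x in Ω, fderiv ℝ (fun x => θ i x * κ x * η x) x ξ := by
    rw [← integral_finsetSum _ fun i _ => ?_]
    · refine setIntegral_congr_fun hΩ.isOpen.measurableSet fun x hx => ?_
      have h2 : (fun y => κ y * η y) =ᶠ[𝓝 x] fun y => ∑ i, θ i y * κ y * η y := by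
        filter_upwards [hΩ.isOpen.mem_nhds hx] with y hy
        rw [← Finset.sum_mul, ← Finset.sum_mul, hsum y (subset_closure hy), one_mul]
      simp only [h2.fderiv_eq (𝕜 := ℝ)]
      rw [fderiv_fun_sum fun i _ => (hw i).differentiable (by simp) x]
      simp
    · exact ((((hw i).continuous_fderiv (by simp)).clm_apply
        continuous_const).integrable_of_hasCompactSupport
        ((hwc i).fderiv_apply (𝕜 := ℝ) ξ)).restrict
  rw [h1, ENNReal.ofNNReal_finsetSum, Finset.sum_mul]
  refine (enorm_sum_le _ _).trans (Finset.sum_le_sum fun i _ => ?_)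
  refine (hC i _ (hw i) (hwc i) ?_).trans ?_
  · simp only [mul_assoc]
    exact tsupport_mul_subset_left
  · rw [ENNReal.coe_mul, mul_assoc]
    refine mul_le_mul' le_rfl ?_
    rw [← lintegral_const_mul' _ _ ENNReal.coe_ne_top]
    refine lintegral_mono fun x => ?_
    rw [enorm_mul]
    refine mul_le_mul' ?_ le_rfl
    rw [← ofReal_norm]
    exact ENNReal.ofReal_le_ofReal (hD i x)

/-- Testing the weak gradient against `κ ∈ C_c^∞(ℝ^d)` yields a boundary term controlled by the
trace. -/
theorem exists_abs_inner_add_inner_le (hΩ : IsBoundedLipschitzDomain Ω) {κ : Space d → ℝ}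
    (hκ : IsTestFunction univ κ) (ξ : Space d) :
    ∃ C : NNReal, ∀ p ∈ smoothTraceGraph Ω,
      |inner ℝ p.1 ((hκ.memLp_inner_gradient (Ω := Ω) ξ 2).toLp _) +
        inner ℝ p.2.1 ((hκ.memLp_smul_const (Ω := Ω) ξ 2).toLp _)| ≤ C * ‖p.2.2‖ := by
  obtain ⟨C, hC⟩ := hΩ.exists_enorm_setIntegral_fderiv_mul_le hκ ξ
  have hfin := hΩ.isFiniteMeasure_surface
  refine ⟨C * (surface Ω univ ^ (1 / 2 : ℝ)).toNNReal, ?_⟩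
  rintro ⟨φ, G, f⟩ ⟨η, hη, h1, h2, h3⟩
  have hη1 : ContDiff ℝ 1 η := hη.of_le (by simp)
  have hcs : HasCompactSupport fun y => κ y * η y := hκ.hasCompactSupport.mul_right
  have e1 : inner ℝ φ ((hκ.memLp_inner_gradient (Ω := Ω) ξ 2).toLp _) +
      inner ℝ G ((hκ.memLp_smul_const (Ω := Ω) ξ 2).toLp _) =
      ∫ x in Ω, fderiv ℝ (fun y => κ y * η y) x ξ := by
    rw [L2.inner_def, L2.inner_def, ← integral_add (L2.integrable_inner _ _)
      (L2.integrable_inner _ _)]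
    refine integral_congr_ae ?_
    filter_upwards [h1, h2, (hκ.memLp_inner_gradient (Ω := Ω) ξ 2).coeFn_toLp,
      (hκ.memLp_smul_const (Ω := Ω) ξ 2).coeFn_toLp] with x k1 k2 k3 k4
    have k1' : φ x = η x := k1
    have k2' : G x = ∇ η x := k2
    rw [k1', k2', k3, k4, fderiv_fun_mul (hκ.differentiable x) (hη1.differentiable (by simp) x),
      real_inner_smul_right]
    simp [inner_gradient_left]
    ring
  rw [e1]
  -- Cauchy–Schwarz on Γ, whose surface measure is finite.
  have e2 : ∫⁻ x, ‖η x‖ₑ ∂surface Ω ≤ ‖f‖ₑ * surface Ω univ ^ (1 / 2 : ℝ) := by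
    rw [← eLpNorm_one_eq_lintegral_enorm, Lp.enorm_def, eLpNorm_congr_ae h3]
    refine (eLpNorm_le_eLpNorm_mul_rpow_measure_univ (p := 1) (q := 2) (by norm_num)
      hη.continuous.aestronglyMeasurable).trans (le_of_eq ?_)
    norm_num
  have e3 := (hC η hη1).trans (mul_le_mul_right e2 _)
  have e4 : surface Ω univ ^ (1 / 2 : ℝ) ≠ ⊤ :=
    ENNReal.rpow_ne_top_of_nonneg (by norm_num) (measure_ne_top _ _)
  rw [← ENNReal.coe_toNNReal e4, enorm_eq_nnnorm, enorm_eq_nnnorm] at e3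
  norm_cast at e3
  have e5 : ‖∫ x in Ω, fderiv ℝ (fun y => κ y * η y) x ξ‖₊ ≤
      C * (surface Ω univ ^ (1 / 2 : ℝ)).toNNReal * ‖f‖₊ := e3.trans (le_of_eq (by ring))
  exact_mod_cast e5

/-- Functions with zero trace belong to `H¹₀(Ω)`. -/
theorem mem_H10_of_hasTrace_zero (hΩ : IsBoundedLipschitzDomain Ω) {φ : H1 Ω}
    (hφ : HasTrace φ 0) : φ.1 ∈ H10 Ω := by
  refine mem_H10_of_forall_integral hΩ fun κ hκ => ?_
  refine (integral_smul_gradient_eq_iff hκ _ _).2 fun ξ => ?_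
  obtain ⟨C, hC⟩ := exists_abs_inner_add_inner_le hΩ hκ ξ
  -- The bound is a closed condition and so survives the limit defining the trace. For trace 0 it
  -- leaves the weak-gradient identity against every κ on ℝ^d.
  have hcl : IsClosed {p : L2 Ω × L2Vec Ω × L2Bdry Ω |
      |inner ℝ p.1 ((hκ.memLp_inner_gradient (Ω := Ω) ξ 2).toLp _) +
        inner ℝ p.2.1 ((hκ.memLp_smul_const (Ω := Ω) ξ 2).toLp _)| ≤ C * ‖p.2.2‖} :=
    isClosed_le (by fun_prop) (by fun_prop)
  have h := closure_minimal hC hcl hφ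
  exact eq_neg_of_add_eq_zero_left (abs_nonpos_iff.1 (le_trans h (by simp)))

theorem hasTrace_zero_of_mem_H10 {φ : H1 Ω} (hΩ : IsOpen Ω) (hφ : φ.1 ∈ H10 Ω) :
    HasTrace φ 0 := by
  have hcl : IsClosed {q : L2 Ω × L2Vec Ω |
      (q.1, q.2, (0 : L2Bdry Ω)) ∈ (smoothTraceGraph Ω).topologicalClosure} :=
    (Submodule.isClosed_topologicalClosure (smoothTraceGraph Ω)).preimage (by fun_prop)
  refine closure_minimal (fun q hq => ?_) hcl hφ
  obtain ⟨η, hη, h1, h2⟩ := hq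
  refine Submodule.le_topologicalClosure _ ⟨η, hη.smooth, h1, h2, ?_⟩
  have hm := ae_restrict_mem (μ := Measure.euclideanHausdorffMeasure (d - 1))
    (isClosed_frontier (s := Ω)).measurableSet
  filter_upwards [Lp.coeFn_zero ℝ 2 (surface Ω), hm] with x hx hxf
  have hx' : x ∉ tsupport η := fun hmem => by
    rw [hΩ.frontier_eq] at hxf
    exact hxf.2 (hη.tsupport_subset hmem)
  rw [hx, image_eq_zero_of_notMem_tsupport hx']
  rfl

end ZeroTrace

/-! ### Dirichlet problem, mixed problem and the two extremal principles -/

section Duality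

variable {d : ℕ} {Ω : Set (Space d)}

theorem grad_sub (φ ψ : H1 Ω) : grad (φ - ψ) = grad φ - grad ψ := rfl

theorem HDiv_ext {σ τ : HDiv Ω} (h1 : field σ = field τ) (h2 : div σ = div τ) : σ = τ :=
  Subtype.ext (Prod.ext h1 h2)

theorem hasTrace_trace (hΩ : IsBoundedLipschitzDomain Ω) (φ : H1 Ω) : HasTrace φ (trace φ) := by
  have h := exists_hasTrace hΩ φ
  rw [trace, dif_pos h]
  exact Classical.choose_spec h

theorem hasTrace_lift (ψ : HHalf Ω) : HasTrace (lift ψ) ψ :=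
  Classical.choose_spec (mem_HHalf.1 ψ.2)

theorem HasTrace.sub {φ ψ : H1 Ω} {f g : L2Bdry Ω} (hφ : HasTrace φ f) (hψ : HasTrace ψ g) :
    HasTrace (φ - ψ) (f - g) :=
  (smoothTraceGraph Ω).topologicalClosure.sub_mem hφ hψ

theorem trace_eq_iff (hΩ : IsBoundedLipschitzDomain Ω) {φ : H1 Ω} {f : HHalf Ω} :
    trace φ = f ↔ HasTrace φ f :=
  ⟨fun h => h ▸ hasTrace_trace hΩ φ, fun h => Subtype.ext ((hasTrace_trace hΩ φ).unique hΩ h)⟩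

theorem trace_sub (hΩ : IsBoundedLipschitzDomain Ω) (φ ψ : H1 Ω) :
    trace (φ - ψ) = trace φ - trace ψ :=
  (trace_eq_iff hΩ).2 ((hasTrace_trace hΩ φ).sub (hasTrace_trace hΩ ψ))

theorem sub_mem_H10_of_trace_eq (hΩ : IsBoundedLipschitzDomain Ω) {φ ψ : H1 Ω}
    (h : trace φ = trace ψ) : (φ - ψ).1 ∈ H10 Ω := by
  refine mem_H10_of_hasTrace_zero hΩ ?_
  have := (hasTrace_trace hΩ φ).sub (hasTrace_trace hΩ ψ)
  rwa [h, sub_self] at this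

/-- The normal trace may be evaluated with any function of the given trace. -/
theorem normalTrace_eq (hΩ : IsBoundedLipschitzDomain Ω) {w : H1 Ω} {f : HHalf Ω}
    (hw : trace w = f) (σ : HDiv Ω) :
    normalTrace σ f = inner ℝ (grad w) (field σ) + inner ℝ (fn w) (div σ) := by
  have h1 : trace (lift f) = trace w := hw.symm ▸ (trace_eq_iff hΩ).2 (hasTrace_lift f)
  -- Two functions with the same trace differ by an element of H¹₀(Ω), on which Green's formula has
  -- no boundary term.
  have h2 := inner_add_inner_eq_zero_of_mem_H10 (sub_mem_H10_of_trace_eq hΩ h1) σ.2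
  change inner ℝ (grad (lift f) - grad w) (field σ) + inner ℝ (fn (lift f) - fn w) (div σ) = 0
    at h2
  rw [inner_sub_left, inner_sub_left] at h2
  rw [normalTrace]
  linarith

/-- A harmonic function has a gradient orthogonal to the gradients of `H¹₀(Ω)`. -/
theorem IsHarmonic.inner_eq_zero {φ : H1 Ω} (hφ : IsHarmonic φ) {p : L2 Ω × L2Vec Ω}
    (hp : p ∈ H10 Ω) : inner ℝ p.2 (grad φ) = 0 := by
  simpa using inner_add_inner_eq_zero_of_mem_H10 hp hφ

theorem IsHarmonic.sub {φ ψ : H1 Ω} (hφ : IsHarmonic φ) (hψ : IsHarmonic ψ) :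
    IsHarmonic (φ - ψ) := by
  have h := (HDiv Ω).sub_mem (x := (grad φ, 0)) (y := (grad ψ, 0)) hφ hψ
  rw [Prod.mk_sub_mk, sub_self] at h
  exact h

theorem eq_zero_of_mem_H10_of_snd_eq_zero (hd : 0 < d) (hΩ : IsBoundedLipschitzDomain Ω)
    {p : L2 Ω × L2Vec Ω} (hp : p ∈ H10 Ω) (h : p.2 = 0) : p = 0 := by
  obtain ⟨C, hC⟩ := exists_norm_fst_le_of_mem_H10 hd hΩ.isOpen.measurableSet hΩ.isBounded
  have h1 := hC p hp
  rw [h, norm_zero, mul_zero] at h1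
  exact Prod.ext (norm_le_zero_iff.1 h1) h

/-- The orthogonal projection onto the gradients of `H¹₀(Ω)`. -/
theorem exists_mem_H10_inner_eq_zero (hd : 0 < d) (hΩ : IsBoundedLipschitzDomain Ω)
    (G : L2Vec Ω) :
    ∃ p ∈ H10 Ω, ∀ q ∈ H10 Ω, inner ℝ q.2 (G - p.2) = 0 := by
  obtain ⟨C, hC⟩ := exists_norm_fst_le_of_mem_H10 hd hΩ.isOpen.measurableSet hΩ.isBounded
  let π : H10 Ω →L[ℝ] L2Vec Ω := (ContinuousLinearMap.snd ℝ _ _).comp (H10 Ω).subtypeL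
  have hc : CompleteSpace (H10 Ω) := isClosed_H10.completeSpace_coe
  -- Poincaré's inequality bounds the gradient map below on H¹₀(Ω), so its range is closed and
  -- admits an orthogonal projection.
  have hanti : AntilipschitzWith (max C 1) π := by
    refine AddMonoidHomClass.antilipschitz_of_bound π fun p => ?_
    have h1 : ‖p.1.1‖ ≤ C * ‖p.1.2‖ := hC p.1 p.2
    have h2 : (C : ℝ) ≤ (max C 1 : NNReal) := by exact_mod_cast le_max_left C 1
    have h3 : (1 : ℝ) ≤ (max C 1 : NNReal) := by exact_mod_cast le_max_right C 1
    refine max_le (h1.trans ?_) ?_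
    · change (C : ℝ) * ‖p.1.2‖ ≤ (max C 1 : NNReal) * ‖p.1.2‖
      gcongr
    · change ‖p.1.2‖ ≤ (max C 1 : NNReal) * ‖p.1.2‖
      exact le_mul_of_one_le_left (norm_nonneg _) h3
  have hcl : IsClosed (range π) := hanti.isClosed_range π.uniformContinuous
  have hcl' : CompleteSpace (LinearMap.range π.toLinearMap) := by
    have : IsClosed (LinearMap.range π.toLinearMap : Set (L2Vec Ω)) := hcl
    exact this.completeSpace_coe
  obtain ⟨_, ⟨p, rfl⟩, z, hz, hG⟩ :=
    (LinearMap.range π.toLinearMap).exists_add_mem_mem_orthogonal G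
  refine ⟨p, p.2, fun q hq => ?_⟩
  have h1 : G - p.1.2 = z := by
    rw [hG]
    exact add_sub_cancel_left _ _
  rw [h1]
  exact (Submodule.mem_orthogonal _ _).1 hz q.2 ⟨⟨q, hq⟩, rfl⟩

/-- The divergences of fields in `H(div, Ω)` are dense in `L²(Ω)`. -/
theorem eq_zero_of_forall_inner_div (hd : 0 < d) (hΩ : IsBoundedLipschitzDomain Ω) {ω : L2 Ω}
    (hω : ∀ σ : HDiv Ω, inner ℝ (div σ) ω = 0) : ω = 0 := by
  -- `WithLp 2` supplies the Hilbert structure that the product with its maximum norm lacks.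
  let J : (L2 Ω × L2Vec Ω) →ₗ[ℝ] WithLp 2 (L2Vec Ω × L2 Ω) :=
    (WithLp.linearEquiv 2 ℝ (L2Vec Ω × L2 Ω)).symm.toLinearMap ∘ₗ
      (LinearMap.snd ℝ _ _).prod (LinearMap.fst ℝ _ _)
  -- The orthogonal complement of the pairs (∇η, η) consists of the pairs (σ, div σ). By hypothesis
  -- (0, ω) is orthogonal to all of these, so it lies in the double complement, the closure of the
  -- pairs (∇η, η). Hence ω belongs to H¹₀(Ω) with gradient 0.
  have hmem : WithLp.toLp 2 ((0 : L2Vec Ω), ω) ∈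
      ((testGraph Ω Ω).map J).topologicalClosure := by
    rw [← Submodule.orthogonal_orthogonal_eq_closure, Submodule.mem_orthogonal]
    intro v hv
    have hdiv : IsWeakDivergence Ω v.fst v.snd := by
      refine isWeakDivergence_iff.2 fun η hη => ?_
      have h := (Submodule.mem_orthogonal _ _).1 hv _ ⟨_, hη.toLp_mem_testGraph, rfl⟩
      simpa [J, WithLp.prod_inner_apply] using h
    have h := hω ⟨(v.fst, v.snd), hdiv⟩
    rw [WithLp.prod_inner_apply]
    simpa [div] using h
  have hback : (ω, (0 : L2Vec Ω)) ∈ H10 Ω := by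
    have hcont : Continuous fun v : WithLp 2 (L2Vec Ω × L2 Ω) => (v.snd, v.fst) := by fun_prop
    have hmaps : MapsTo (fun v : WithLp 2 (L2Vec Ω × L2 Ω) => (v.snd, v.fst))
        ((testGraph Ω Ω).map J) (testGraph Ω Ω) := by
      rintro _ ⟨q, hq, rfl⟩
      exact hq
    have h := map_mem_closure (f := fun v : WithLp 2 (L2Vec Ω × L2 Ω) => (v.snd, v.fst))
      hcont hmem hmaps
    exact h
  exact congrArg Prod.fst (eq_zero_of_mem_H10_of_snd_eq_zero hd hΩ hback rfl)

/-- Existence and uniqueness for the Dirichlet problem. -/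
theorem existsUnique_isDirichletSolution (hd : 0 < d) (hΩ : IsBoundedLipschitzDomain Ω)
    (g : HHalf Ω) : ∃! u : H1 Ω, IsDirichletSolution g u := by
  obtain ⟨p, hp, hpq⟩ := exists_mem_H10_inner_eq_zero hd hΩ (grad (lift g))
  let φ : H1 Ω := ⟨p, H10_le_H1 hp⟩
  refine ⟨lift g - φ, ⟨?_, ?_⟩, ?_⟩
  · refine isWeakDivergence_iff.2 fun η hη => ?_
    rw [inner_zero_right, add_zero]
    exact hpq _ (testGraph_le_H10 hη.toLp_mem_testGraph)
  · refine (trace_eq_iff hΩ).2 ?_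
    simpa using (hasTrace_lift g).sub (hasTrace_zero_of_mem_H10 (φ := φ) hΩ.isOpen hp)
  · rintro u ⟨hu, hug⟩
    have htr : trace u = trace (lift g - φ) := by
      rw [hug]
      refine ((trace_eq_iff hΩ).2 ?_).symm
      simpa using (hasTrace_lift g).sub (hasTrace_zero_of_mem_H10 (φ := φ) hΩ.isOpen hp)
    have hmem := sub_mem_H10_of_trace_eq hΩ htr
    have h1 := hu.inner_eq_zero hmem
    have h2 := hpq _ hmem
    -- The gradient of the difference of two solutions is orthogonal to itself.
    have h3 : inner ℝ (u - (lift g - φ)).1.2 (grad u - (grad (lift g) - p.2)) = 0 := by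
      rw [inner_sub_right, h1, h2, sub_zero]
    have h4 : (u - (lift g - φ)).1.2 = 0 := inner_self_eq_zero.1 h3
    exact sub_eq_zero.1 (Subtype.ext (eq_zero_of_mem_H10_of_snd_eq_zero hd hΩ hmem h4))

/-- The gradient of a harmonic function, as an element of `H(div, Ω)`. -/
noncomputable def IsHarmonic.gradHDiv {φ : H1 Ω} (hφ : IsHarmonic φ) : HDiv Ω := ⟨(grad φ, 0), hφ⟩

/-- The first equation is the Green formula defining the normal trace, evaluated with w as the lift
of its own trace. -/
theorem IsHarmonic.isMixedSolution (hΩ : IsBoundedLipschitzDomain Ω) {w : H1 Ω}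
    (hw : IsHarmonic w) : IsMixedSolution (trace w) hw.gradHDiv (fn w) := by
  intro σ ψ
  refine ⟨?_, inner_zero_left _⟩
  rw [normalTrace_eq hΩ rfl, real_inner_comm (fn w)]
  rfl

/-- The second equation with ψ = div τ makes both fields divergence-free. Testing the difference of
the first equations with τ - τ' then removes the ω-term and gives τ = τ', after which ω - ω' is
orthogonal to every divergence. -/
theorem IsMixedSolution.unique (hd : 0 < d) (hΩ : IsBoundedLipschitzDomain Ω) {f : HHalf Ω}
    {τ τ' : HDiv Ω} {ω ω' : L2 Ω} (h : IsMixedSolution f τ ω) (h' : IsMixedSolution f τ' ω') :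
    τ = τ' ∧ ω = ω' := by
  have hdiv : ∀ {τ : HDiv Ω} {ω : L2 Ω}, IsMixedSolution f τ ω → div τ = 0 := fun {τ _} h =>
    inner_self_eq_zero.1 (h 0 (div τ)).2
  have hsub : ∀ σ : HDiv Ω, inner ℝ (field τ - field τ') (field σ) +
      inner ℝ (div σ) (ω - ω') = 0 := by
    intro σ
    have h1 := (h σ 0).1
    have h2 := (h' σ 0).1
    rw [inner_sub_left, inner_sub_right]
    linarith
  have hτ : field τ = field τ' := by
    have h1 := hsub (τ - τ')
    have h2 : field (τ - τ') = field τ - field τ' := rfl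
    have h3 : div (τ - τ') = div τ - div τ' := rfl
    rw [h2, h3, hdiv h, hdiv h', sub_self, inner_zero_left, add_zero] at h1
    exact sub_eq_zero.1 (inner_self_eq_zero.1 h1)
  refine ⟨HDiv_ext hτ ((hdiv h).trans (hdiv h').symm), sub_eq_zero.1 ?_⟩
  refine eq_zero_of_forall_inner_div hd hΩ fun σ => ?_
  simpa [hτ] using hsub σ

/-- For a divergence-free field the normal trace pairing is (∇w, σ), and the square can be
completed. Harmonicity of w plays no role yet; it enters only in making ∇w itself an admissible
field. -/
theorem minorant_eq (hΩ : IsBoundedLipschitzDomain Ω) (w : H1 Ω) {σ : HDiv Ω} (hσ : div σ = 0) :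
    minorant (trace w) σ = ‖grad w‖ ^ 2 - ‖grad w - field σ‖ ^ 2 := by
  rw [minorant, normalTrace_eq hΩ rfl, hσ, inner_zero_right, add_zero, norm_sub_sq_real]
  ring

theorem IsHarmonic.isUniqueMaximiser (hΩ : IsBoundedLipschitzDomain Ω) {w : H1 Ω}
    (hw : IsHarmonic w) :
    IsUniqueMaximiser (minorant (trace w)) {σ : HDiv Ω | div σ = 0} hw.gradHDiv := by
  refine ⟨rfl, fun σ hσ hne => ?_⟩
  rw [minorant_eq hΩ w hσ, minorant_eq hΩ w (σ := hw.gradHDiv) rfl]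
  have h1 : grad w - field hw.gradHDiv = 0 := sub_self _
  have h2 : grad w - field σ ≠ 0 := fun h0 =>
    hne (HDiv_ext (sub_eq_zero.1 h0).symm hσ)
  have h3 : 0 < ‖grad w - field σ‖ := norm_pos_iff.2 h2
  rw [h1, norm_zero]
  nlinarith

/-- Competitors differ from w by elements of H¹₀(Ω), whose gradients are orthogonal to ∇w, so
Pythagoras applies. Poincaré's inequality makes the excess ‖∇(w' - w)‖² strictly positive. -/
theorem IsHarmonic.isUniqueMinimiser (hd : 0 < d) (hΩ : IsBoundedLipschitzDomain Ω) {w : H1 Ω}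
    (hw : IsHarmonic w) :
    IsUniqueMinimiser majorant {w' : H1 Ω | trace w' = trace w} w := by
  refine ⟨rfl, fun w' hw' hne => ?_⟩
  have hmem := sub_mem_H10_of_trace_eq hΩ hw'
  have h1 : inner ℝ (grad (w' - w)) (grad w) = 0 := hw.inner_eq_zero hmem
  have h2 : grad (w' - w) ≠ 0 := fun h0 => hne (sub_eq_zero.1
    (Subtype.ext (eq_zero_of_mem_H10_of_snd_eq_zero hd hΩ hmem h0)))
  have h3 : grad w' = grad (w' - w) + grad w := by rw [grad_sub]; abel
  have h4 : 0 < ‖grad (w' - w)‖ := norm_pos_iff.2 h2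
  rw [majorant, majorant, h3, norm_add_sq_real, h1]
  nlinarith

end Duality

end FunctionalBEM


/-! ### The main theorem -/

theorem mainTheorem4 {d : ℕ} (hd : 2 ≤ d) (Ω : Set (FunctionalBEM.Space d))
    (hΩ : FunctionalBEM.IsBoundedLipschitzDomain Ω)
    (g : FunctionalBEM.HHalf Ω) (v : FunctionalBEM.H1 Ω) (hv : FunctionalBEM.IsHarmonic v) :
    (∃! u : FunctionalBEM.H1 Ω, FunctionalBEM.IsDirichletSolution g u) ∧
    (∃! p : FunctionalBEM.HDiv Ω × FunctionalBEM.L2 Ω,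
      FunctionalBEM.IsMixedSolution (g - FunctionalBEM.trace v) p.1 p.2) ∧
    ∀ (u : FunctionalBEM.H1 Ω) (τ : FunctionalBEM.HDiv Ω) (ω : FunctionalBEM.L2 Ω),
      FunctionalBEM.IsDirichletSolution g u →
      FunctionalBEM.IsMixedSolution (g - FunctionalBEM.trace v) τ ω →
        FunctionalBEM.field τ = FunctionalBEM.grad (u - v) ∧
        ω = FunctionalBEM.fn (u - v) ∧
        FunctionalBEM.IsUniqueMaximiser (FunctionalBEM.minorant (g - FunctionalBEM.trace v))
          {σ : FunctionalBEM.HDiv Ω | FunctionalBEM.div σ = 0} τ ∧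
        FunctionalBEM.IsUniqueMinimiser FunctionalBEM.majorant
          {w : FunctionalBEM.H1 Ω | FunctionalBEM.trace w = g - FunctionalBEM.trace v}
          (u - v) := by
  have hd0 : 0 < d := by omega
  -- The datum g - v|_Γ is the trace of the harmonic function u - v, which reduces the mixed and
  -- extremal claims to the results for one harmonic function.
  have htr : ∀ {u : FunctionalBEM.H1 Ω}, FunctionalBEM.IsDirichletSolution g u →
      g - FunctionalBEM.trace v = FunctionalBEM.trace (u - v) := fun hu => by
    rw [FunctionalBEM.trace_sub hΩ, hu.2]
  have hdir := FunctionalBEM.existsUnique_isDirichletSolution hd0 hΩ g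
  refine ⟨hdir, ?_, fun u τ ω hu hτ => ?_⟩
  · obtain ⟨u, hu, -⟩ := hdir
    have hw := hu.1.sub hv
    rw [htr hu]
    refine ⟨(hw.gradHDiv, FunctionalBEM.fn (u - v)), hw.isMixedSolution hΩ, fun p hp => ?_⟩
    obtain ⟨h1, h2⟩ := hp.unique hd0 hΩ (hw.isMixedSolution hΩ)
    exact Prod.ext h1 h2
  · have hw := hu.1.sub hv
    rw [htr hu] at hτ ⊢
    obtain ⟨rfl, rfl⟩ := hτ.unique hd0 hΩ (hw.isMixedSolution hΩ)
    exact ⟨rfl, rfl, hw.isUniqueMaximiser hΩ, hw.isUniqueMinimiser hd0 hΩ⟩
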